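/- Let $A$ be a von Neumann algebra with a finite, faithful, normal trace $\tau\colon A\to\mathbb C$, normalized by $\tau(1)=1$. Let $l^2(A)$ be the Hilbert space completion of $A$ with respect to $\langle a,b\rangle_\tau=\tau(ab^*)$, on which $A$ acts by right multiplication. An \emph{$A$-Hilbert space} is a Hilbert space $H$ with a right $A$-module structure such that $\langle xa^*,y\rangle=\langle x,ya\rangle$ for $a\in A$, $x,y\in H$, and such that there is an isometric $A$-linear embedding $i\colon H\hookrightarrow l^2(A)\otimes V$ for some separable Hilbert space $V$. For a positive bounded $A$-linear operator $P$ on $H$ let $\operatorname{Tr}_\tau P\in[0,\infty]$ be its von Neumann trace, $\operatorname{Tr}_\tau P=\sum_j\langle iPi^*(1\otimes e_j),1\otimes e_j\rangle$ for an orthonormal basis $(e_j)$ of $V$ (this does not depend on the choices). An \emph{$A$-Hilbert subspace} of $H$ is a closed $A$-invariant subspace $L$; its $\tau$-dimension $\dim_\tau L$ is $\operatorname{Tr}_\tau$ of the orthogonal projection onto $L$. For a self-adjoint operator $S$ on $H$ commuting with the action of $A$ and $\lambda\in\mathbb R$, put $N_\tau(\lambda;S)=\operatorname{Tr}_\tau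 P_\lambda$, where $P_\lambda$ is the orthogonal projection onto the spectral subspace of $S$ corresponding to $(-\infty,\lambda]$. Let $H_1,H_2$ be $A$-Hilbert spaces and let $T\colon\operatorname{Dom}(T)\subset H_1\to H_2$ be a closed $A$-operator, i.e. a densely defined closed linear operator such that $xa\in\operatorname{Dom}(T)$ and $T(xa)=(Tx)a$ for all $x\in\operatorname{Dom}(T)$, $a\in A$. Let $$\mathcal T=\begin{pmatrix}0&T^*\\ T&0\end{pmatrix}\colon H_1\oplus H_2\to H_1\oplus H_2,\qquad \operatorname{Dom}(\mathcal T)=\operatorname{Dom}(T)\oplus\operatorname{Dom}(T^*).$$ Then the following are equivalent: (a) $T$ is $\tau$-Fredholm, i.e. $\dim_\tau\ker T<\infty$ and there is an $A$-Hilbert subspace $L$ of $H_2$ with $L\subset\operatorname{im}T$ and $\dim_\tau L^\perp<\infty$; (b) there exists $\lambda>0$ such that $N_\tau(\lambda;\mathcal T^2)<\infty$. -/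

import Mathlib

open scoped ComplexOrder InnerProductSpace TensorProduct ENNReal Topology
open UniformSpace Filter MeasureTheory

noncomputable section

namespace VN

/-! ### Traces and the Hilbert space `l²(A)` -/

/-- A finite, faithful, normal trace `τ : A → ℂ` with `τ 1 = 1`. (`A →ₚ[ℂ] ℂ` is the type of
positive, everywhere defined, complex linear functionals.) -/
structure FiniteTrace (A : Type*) [CStarAlgebra A] [PartialOrder A] [StarOrderedRing A] where
  /-- the underlying positive linear functional -/
  functional : A →ₚ[ℂ] ℂ
  map_one : functional 1 = 1
  tracial : ∀ a b : A, functional (a * b) = functional (b * a)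
  faithful : ∀ a : A, 0 ≤ a → functional a = 0 → a = 0
  /-- `τ` preserves suprema of bounded increasing nets of positive elements -/
  normal : ∀ (D : Set A) (x : A), D.Nonempty → DirectedOn (· ≤ ·) D → (∀ d ∈ D, 0 ≤ d) →
    IsLUB D x → IsLUB ((fun d => (functional d).re) '' D) (functional x).re

section L2

variable {A : Type*} [CStarAlgebra A] [PartialOrder A] [StarOrderedRing A] (τ : FiniteTrace A)

/-- `l²(A)`: the completion of `A` in the inner product `⟨a, b⟩ = τ (a b*)`. With Mathlib's
convention (conjugate linear in the first slot) this is `⟪b, a⟫ = τ (b* a)`, i.e. Mathlib's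
GNS space of `τ`; see `inner_l2`. -/
abbrev L2 : Type _ := τ.functional.GNS

/-- The vector of `l²(A)` given by an element of `A`. -/
def toL2 (a : A) : L2 τ := ((τ.functional.toPreGNS a : τ.functional.PreGNS) : L2 τ)

theorem inner_l2 (a b : A) : ⟪toL2 τ b, toL2 τ a⟫_ℂ = τ.functional (a * star b) := by
  simp only [toL2, Completion.inner_coe, PositiveLinearMap.preGNS_inner_def,
    PositiveLinearMap.ofPreGNS_toPreGNS]
  exact τ.tracial _ _

theorem norm_toPreGNS_star (a : A) :
    ‖τ.functional.toPreGNS (star a)‖ = ‖τ.functional.toPreGNS a‖ := by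
  simp only [PositiveLinearMap.preGNS_norm_def, PositiveLinearMap.ofPreGNS_toPreGNS, star_star]
  rw [τ.tracial]

/-- Right multiplication by `a` on `A`, bounded for the `l²`-norm. -/
def rightMulPre (a : A) : τ.functional.PreGNS →L[ℂ] τ.functional.PreGNS :=
  (τ.functional.toPreGNS.toLinearMap ∘ₗ LinearMap.mulRight ℂ a ∘ₗ
    τ.functional.ofPreGNS.toLinearMap).mkContinuous
    ‖τ.functional.leftMulMapPreGNS (star a)‖ fun x => by
      have h := (τ.functional.leftMulMapPreGNS (star a)).le_opNorm
        (τ.functional.toPreGNS (star (τ.functional.ofPreGNS x)))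
      rw [norm_toPreGNS_star, PositiveLinearMap.toPreGNS_ofPreGNS,
        PositiveLinearMap.leftMulMapPreGNS_apply, PositiveLinearMap.ofPreGNS_toPreGNS,
        ← star_mul, norm_toPreGNS_star] at h
      exact h

/-- The right action of `A` on `l²(A)`: the continuous extension of `x ↦ x a`. -/
def rightMul (a : A) : L2 τ →L[ℂ] L2 τ := (rightMulPre τ a).completion

theorem rightMul_toL2 (a x : A) : rightMul τ a (toL2 τ x) = toL2 τ (x * a) := by
  rw [rightMul, toL2, ContinuousLinearMap.completion_apply_coe]
  rfl

/-- The Hilbert space tensor product `l²(A) ⊗ V`. -/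
abbrev L2Tensor (V : Type*) [NormedAddCommGroup V] [InnerProductSpace ℂ V] : Type _ :=
  Completion (L2 τ ⊗[ℂ] V)

/-- The right action of `A` on `l²(A) ⊗ V`: the continuous extension of
`ξ ⊗ v ↦ (ξ a) ⊗ v`. -/
def rightMulTensor (V : Type*) [NormedAddCommGroup V] [InnerProductSpace ℂ V] (a : A) :
    L2Tensor τ V →L[ℂ] L2Tensor τ V :=
  ((rightMul τ a).rTensor V).completion

end L2

/-! ### `A`-Hilbert spaces, trace and dimension -/

section AHilbert

variable {A : Type*} [CStarAlgebra A] [PartialOrder A] [StarOrderedRing A] (τ : FiniteTrace A)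

/-- An isometric `A`-linear embedding `H → l²(A) ⊗ V` with `V` a separable Hilbert space.
Right `A`-modules are `Aᵐᵒᵖ`-modules: `x a` is `MulOpposite.op a • x`. (Every separable Hilbert
space is isometric to one in the lowest universe, so taking `V : Type` is no restriction.) -/
structure AEmbedding (H : Type*) [NormedAddCommGroup H] [InnerProductSpace ℂ H]
    [Module Aᵐᵒᵖ H] where
  V : Type
  [normed : NormedAddCommGroup V]
  [inner : InnerProductSpace ℂ V]
  [complete : CompleteSpace V]
  [separable : TopologicalSpace.SeparableSpace V]
  emb : H →ₗᵢ[ℂ] L2Tensor τ V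
  emb_smul : ∀ (a : A) (x : H), emb (MulOpposite.op a • x) = rightMulTensor τ V a (emb x)

attribute [instance] AEmbedding.normed AEmbedding.inner AEmbedding.complete AEmbedding.separable

/-- A Hilbert space `H` with a right `A`-module structure is an `A`-Hilbert space if the action is
compatible with the inner product, `⟨x a*, y⟩ = ⟨x, y a⟩`, and `H` has an isometric `A`-linear
embedding into some `l²(A) ⊗ V` with `V` separable. -/
class AHilbertSpace (H : Type*) [NormedAddCommGroup H] [InnerProductSpace ℂ H]
    [Module Aᵐᵒᵖ H] : Prop where
  compatible : ∀ (a : A) (x y : H),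
    ⟪MulOpposite.op (star a) • x, y⟫_ℂ = ⟪x, MulOpposite.op a • y⟫_ℂ
  exists_embedding : Nonempty (AEmbedding τ H)

section Sum

variable {V₁ V₂ : Type*} [NormedAddCommGroup V₁] [InnerProductSpace ℂ V₁]
  [NormedAddCommGroup V₂] [InnerProductSpace ℂ V₂]

/-- `id ⊗ j : l²(A) ⊗ V₁ → l²(A) ⊗ V₂` for an isometry `j : V₁ → V₂`. -/
def tensorMap (j : V₁ →ₗᵢ[ℂ] V₂) : L2Tensor τ V₁ →L[ℂ] L2Tensor τ V₂ :=
  (j.lTensor (L2 τ)).toContinuousLinearMap.completion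

theorem inner_tensorMap {V : Type*} [NormedAddCommGroup V] [InnerProductSpace ℂ V]
    (j : V₁ →ₗᵢ[ℂ] V) (k : V₂ →ₗᵢ[ℂ] V) (h : ∀ v w, ⟪j v, k w⟫_ℂ = 0)
    (x : L2Tensor τ V₁) (y : L2Tensor τ V₂) : ⟪tensorMap τ j x, tensorMap τ k y⟫_ℂ = 0 := by
  induction x, y using Completion.induction_on₂ with
  | hp => apply isClosed_eq <;> fun_prop
  | ih x y =>
    simp only [tensorMap, ContinuousLinearMap.completion_apply_coe, Completion.inner_coe]
    induction x using TensorProduct.induction_on with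
    | zero => simp
    | add a b ha hb => rw [map_add, inner_add_left, ha, hb, add_zero]
    | tmul a v =>
      induction y using TensorProduct.induction_on with
      | zero => simp
      | add a b ha hb => rw [map_add, inner_add_right, ha, hb, add_zero]
      | tmul b w => simp [LinearIsometry.lTensor_def, h]

theorem norm_tensorMap (j : V₁ →ₗᵢ[ℂ] V₂) (x : L2Tensor τ V₁) : ‖tensorMap τ j x‖ = ‖x‖ := by
  induction x using Completion.induction_on with
  | hp => apply isClosed_eq <;> fun_prop
  | ih x =>
    rw [tensorMap, ContinuousLinearMap.completion_apply_coe, Completion.norm_coe,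
      Completion.norm_coe]
    exact (j.lTensor (L2 τ)).norm_map x

theorem tensorMap_rightMul (j : V₁ →ₗᵢ[ℂ] V₂) (a : A) (x : L2Tensor τ V₁) :
    tensorMap τ j (rightMulTensor τ V₁ a x) = rightMulTensor τ V₂ a (tensorMap τ j x) := by
  induction x using Completion.induction_on with
  | hp => apply isClosed_eq <;> fun_prop
  | ih x =>
    simp only [tensorMap, rightMulTensor, ContinuousLinearMap.completion_apply_coe]
    congr 1
    induction x using TensorProduct.induction_on with
    | zero => simp
    | add a b ha hb => simp only [map_add, ha, hb]
    | tmul a v => simp [LinearIsometry.lTensor_def]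

end Sum

variable {H₁ H₂ : Type*} [NormedAddCommGroup H₁] [InnerProductSpace ℂ H₁] [Module Aᵐᵒᵖ H₁]
  [NormedAddCommGroup H₂] [InnerProductSpace ℂ H₂] [Module Aᵐᵒᵖ H₂]

/-- Inclusion of the first summand in a Hilbert direct sum. -/
def inlIso (V₁ V₂ : Type*) [NormedAddCommGroup V₁] [InnerProductSpace ℂ V₁]
    [NormedAddCommGroup V₂] [InnerProductSpace ℂ V₂] : V₁ →ₗᵢ[ℂ] WithLp 2 (V₁ × V₂) where
  toLinearMap := (WithLp.linearEquiv 2 ℂ (V₁ × V₂)).symm.toLinearMap ∘ₗ LinearMap.inl ℂ V₁ V₂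
  norm_map' x := by simp

/-- Inclusion of the second summand in a Hilbert direct sum. -/
def inrIso (V₁ V₂ : Type*) [NormedAddCommGroup V₁] [InnerProductSpace ℂ V₁]
    [NormedAddCommGroup V₂] [InnerProductSpace ℂ V₂] : V₂ →ₗᵢ[ℂ] WithLp 2 (V₁ × V₂) where
  toLinearMap := (WithLp.linearEquiv 2 ℂ (V₁ × V₂)).symm.toLinearMap ∘ₗ LinearMap.inr ℂ V₁ V₂
  norm_map' x := by simp

instance separableSpace_withLp_prod (V₁ V₂ : Type*) [NormedAddCommGroup V₁]
    [NormedAddCommGroup V₂] [TopologicalSpace.SeparableSpace V₁]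
    [TopologicalSpace.SeparableSpace V₂] :
    TopologicalSpace.SeparableSpace (WithLp 2 (V₁ × V₂)) :=
  (WithLp.homeomorphProd 2 V₁ V₂).symm.surjective.denseRange.separableSpace
    (WithLp.homeomorphProd 2 V₁ V₂).symm.continuous

/-- The embedding `H₁ ⊕ H₂ → l²(A) ⊗ (V₁ ⊕ V₂)` given by embeddings of `H₁` and `H₂`. -/
def AEmbedding.prod (i₁ : AEmbedding τ H₁) (i₂ : AEmbedding τ H₂) :
    AEmbedding τ (WithLp 2 (H₁ × H₂)) where
  V := WithLp 2 (i₁.V × i₂.V)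
  emb :=
    { toFun := fun z => tensorMap τ (inlIso i₁.V i₂.V) (i₁.emb z.fst) +
        tensorMap τ (inrIso i₁.V i₂.V) (i₂.emb z.snd)
      map_add' := fun x y => by
        simp only [WithLp.add_fst, WithLp.add_snd, map_add]
        abel
      map_smul' := fun c x => by
        simp only [WithLp.smul_fst, WithLp.smul_snd, map_smul, smul_add, RingHom.id_apply]
      norm_map' := fun z => by
        have h := norm_add_sq_eq_norm_sq_add_norm_sq_of_inner_eq_zero (𝕜 := ℂ)
          (tensorMap τ (inlIso i₁.V i₂.V) (i₁.emb z.fst))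
          (tensorMap τ (inrIso i₁.V i₂.V) (i₂.emb z.snd))
          (inner_tensorMap τ _ _ (fun v w => by simp [inlIso, inrIso]) _ _)
        rw [norm_tensorMap, norm_tensorMap, LinearIsometry.norm_map, LinearIsometry.norm_map] at h
        have h2 := WithLp.prod_norm_sq_eq_of_L2 z
        rw [← sq_eq_sq₀ (norm_nonneg _) (norm_nonneg _), h2]
        simpa [sq] using h }
  emb_smul a z := by
    change tensorMap τ (inlIso i₁.V i₂.V) (i₁.emb (MulOpposite.op a • z.fst)) +
      tensorMap τ (inrIso i₁.V i₂.V) (i₂.emb (MulOpposite.op a • z.snd)) =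
      rightMulTensor τ _ a (tensorMap τ (inlIso i₁.V i₂.V) (i₁.emb z.fst) +
        tensorMap τ (inrIso i₁.V i₂.V) (i₂.emb z.snd))
    rw [i₁.emb_smul, i₂.emb_smul, tensorMap_rightMul, tensorMap_rightMul, map_add]

/-- The Hilbert direct sum of two `A`-Hilbert spaces, with the diagonal action, is an `A`-Hilbert
space. -/
instance AHilbertSpace.prod [h₁ : AHilbertSpace τ H₁] [h₂ : AHilbertSpace τ H₂] :
    AHilbertSpace τ (WithLp 2 (H₁ × H₂)) where
  compatible a x y := by
    rw [WithLp.prod_inner_apply, WithLp.prod_inner_apply]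
    exact congrArg₂ (· + ·) (h₁.compatible a x.fst y.fst) (h₂.compatible a x.snd y.snd)
  exists_embedding := h₁.exists_embedding.elim fun i₁ => h₂.exists_embedding.elim fun i₂ =>
    ⟨i₁.prod τ i₂⟩

/-- The trace `Tr_τ P` of a positive bounded `A`-linear operator `P` on `H`, computed in an
embedding `i : H → l²(A) ⊗ V` and a Hilbert basis `e` of `V`: it is
`∑ⱼ ⟨i P i* (1 ⊗ eⱼ), 1 ⊗ eⱼ⟩`, i.e. the value of `τ ⊗ Tr` on `i P i*`. -/
def traceIn {H : Type*} [NormedAddCommGroup H] [InnerProductSpace ℂ H] [CompleteSpace H]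
    [Module Aᵐᵒᵖ H] (i : AEmbedding τ H) {ι : Type} (e : HilbertBasis ι ℂ i.V)
    (P : H →L[ℂ] H) : ℝ≥0∞ :=
  ∑' j, ENNReal.ofReal
    (⟪((toL2 τ 1 ⊗ₜ[ℂ] e j : L2 τ ⊗[ℂ] i.V) : L2Tensor τ i.V),
      i.emb (P (ContinuousLinearMap.adjoint i.emb.toContinuousLinearMap
        ((toL2 τ 1 ⊗ₜ[ℂ] e j : L2 τ ⊗[ℂ] i.V) : L2Tensor τ i.V)))⟫_ℂ).re

/-- The (possibly infinite) trace `Tr_τ P` of a positive bounded `A`-linear operator `P` on an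
`A`-Hilbert space `H`. The value does not depend on the embedding and on the basis used. -/
def vnTrace {H : Type*} [NormedAddCommGroup H] [InnerProductSpace ℂ H] [CompleteSpace H]
    [Module Aᵐᵒᵖ H] [h : AHilbertSpace τ H] (P : H →L[ℂ] H) : ℝ≥0∞ :=
  traceIn τ h.exists_embedding.some
    (exists_hilbertBasis ℂ h.exists_embedding.some.V).choose_spec.choose P

/-- The `τ`-dimension of a closed `A`-invariant subspace `L` of an `A`-Hilbert space: the trace of
the orthogonal projection onto `L`. (The closure makes the expression meaningful for every
subspace; it does nothing to a closed one.) -/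
def vnDim {H : Type*} [NormedAddCommGroup H] [InnerProductSpace ℂ H] [CompleteSpace H]
    [Module Aᵐᵒᵖ H] [AHilbertSpace τ H] (L : Submodule ℂ H) : ℝ≥0∞ :=
  vnTrace τ L.topologicalClosure.starProjection

/-- `L` is an `A`-Hilbert subspace of `H`: it is closed and `A`-invariant. -/
def IsAHilbertSubspace (A : Type*) [CStarAlgebra A] {H : Type*} [NormedAddCommGroup H]
    [InnerProductSpace ℂ H] [Module Aᵐᵒᵖ H] (L : Submodule ℂ H) : Prop :=
  IsClosed (L : Set H) ∧ ∀ (a : A), ∀ x ∈ L, MulOpposite.op a • x ∈ L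

/-! ### Unbounded `A`-operators and `τ`-Fredholmness -/

/-- A closed `A`-operator `T : Dom T ⊂ H₁ → H₂`: a densely defined closed operator whose domain is
`A`-invariant and which commutes with the action of `A`. -/
structure IsClosedAOperator (A : Type*) [CStarAlgebra A] {H₁ H₂ : Type*}
    [NormedAddCommGroup H₁] [InnerProductSpace ℂ H₁] [Module Aᵐᵒᵖ H₁]
    [NormedAddCommGroup H₂] [InnerProductSpace ℂ H₂] [Module Aᵐᵒᵖ H₂]
    (T : H₁ →ₗ.[ℂ] H₂) : Prop where
  dense : Dense (T.domain : Set H₁)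
  closed : T.IsClosed
  smul : ∀ (a : A) (x : T.domain), ∃ h : MulOpposite.op a • (x : H₁) ∈ T.domain,
    T ⟨MulOpposite.op a • (x : H₁), h⟩ = MulOpposite.op a • T x

/-- The kernel of an unbounded operator, as a subspace of the ambient space. -/
def kernel {H₁ H₂ : Type*} [NormedAddCommGroup H₁] [InnerProductSpace ℂ H₁]
    [NormedAddCommGroup H₂] [InnerProductSpace ℂ H₂] (T : H₁ →ₗ.[ℂ] H₂) : Submodule ℂ H₁ :=
  (LinearMap.ker T.toFun).map T.domain.subtype

/-- `τ`-Fredholmness: the kernel has finite `τ`-dimension, and the image contains an `A`-Hilbert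
subspace whose orthogonal complement has finite `τ`-dimension. -/
def IsTauFredholm [CompleteSpace H₁] [CompleteSpace H₂] [AHilbertSpace τ H₁] [AHilbertSpace τ H₂]
    (T : H₁ →ₗ.[ℂ] H₂) : Prop :=
  vnDim τ (kernel T) < ∞ ∧
    ∃ L : Submodule ℂ H₂, IsAHilbertSubspace A L ∧ (L : Set H₂) ⊆ Set.range T ∧ vnDim τ Lᗮ < ∞

end AHilbert

/-! ### The operators `𝒯` and `𝒯²` -/

section Operators

variable {H₁ H₂ H : Type*} [NormedAddCommGroup H₁] [InnerProductSpace ℂ H₁] [CompleteSpace H₁]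
  [NormedAddCommGroup H₂] [InnerProductSpace ℂ H₂] [CompleteSpace H₂]
  [NormedAddCommGroup H] [InnerProductSpace ℂ H]

/-- The operator `(x, y) ↦ (T* y, T x)` on the Hilbert direct sum `H₁ ⊕ H₂`, with domain
`Dom T ⊕ Dom T*`. -/
def offDiag (T : H₁ →ₗ.[ℂ] H₂) : WithLp 2 (H₁ × H₂) →ₗ.[ℂ] WithLp 2 (H₁ × H₂) where
  domain := (T.domain.prod T.adjoint.domain).comap
    (WithLp.linearEquiv 2 ℂ (H₁ × H₂)).toLinearMap
  toFun :=
    { toFun := fun z => WithLp.toLp 2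
        (T.adjoint ⟨(z : WithLp 2 (H₁ × H₂)).snd, z.2.2⟩, T ⟨(z : WithLp 2 (H₁ × H₂)).fst, z.2.1⟩)
      map_add' := fun z w => by
        rw [← WithLp.toLp_add, Prod.mk_add_mk, ← LinearPMap.map_add, ← LinearPMap.map_add]
        rfl
      map_smul' := fun c z => by
        rw [RingHom.id_apply, ← WithLp.toLp_smul, Prod.smul_mk, ← LinearPMap.map_smul,
          ← LinearPMap.map_smul]
        rfl }

/-- The natural domain `{x ∈ Dom S | S x ∈ Dom S}` of `S²`. -/
def squareDomain (S : H →ₗ.[ℂ] H) : Submodule ℂ H :=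
  (S.domain.comap S.toFun).map S.domain.subtype

theorem mem_squareDomain (S : H →ₗ.[ℂ] H) (x : H) :
    x ∈ squareDomain S ↔ ∃ h : x ∈ S.domain, S ⟨x, h⟩ ∈ S.domain := by
  constructor
  · rintro ⟨y, h, rfl⟩
    exact ⟨y.2, h⟩
  · rintro ⟨h, h'⟩
    exact ⟨⟨x, h⟩, h', rfl⟩

/-- The square `x ↦ S (S x)` of an unbounded operator, on its natural domain. -/
def square (S : H →ₗ.[ℂ] H) : H →ₗ.[ℂ] H where
  domain := squareDomain S
  toFun :=
    { toFun := fun x => S ⟨S ⟨x, ((mem_squareDomain S x).1 x.2).1⟩,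
        ((mem_squareDomain S x).1 x.2).2⟩
      map_add' := fun x y => by
        rw [← LinearPMap.map_add]
        congr 1
        exact Subtype.ext (S.map_add ⟨x, ((mem_squareDomain S x).1 x.2).1⟩
          ⟨y, ((mem_squareDomain S y).1 y.2).1⟩)
      map_smul' := fun c x => by
        rw [RingHom.id_apply, ← LinearPMap.map_smul]
        congr 1
        exact Subtype.ext (S.map_smul c ⟨x, ((mem_squareDomain S x).1 x.2).1⟩) }

/-! ### Spectral resolutions and the spectral counting function -/

/-- A spectral family (resolution of the identity) `(E t)` on a Hilbert space: an increasing,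
strongly right continuous family of orthogonal projections with strong limits `0` at `-∞` and `1`
at `+∞`. -/
structure SpectralFamily (H : Type*) [NormedAddCommGroup H] [InnerProductSpace ℂ H]
    [CompleteSpace H] where
  proj : ℝ → H →L[ℂ] H
  isStarProjection : ∀ t, IsStarProjection (proj t)
  proj_mul : ∀ s t, s ≤ t → proj s * proj t = proj s
  right_continuous : ∀ (x : H) (t : ℝ), Tendsto (fun s => proj s x) (𝓝[>] t) (𝓝 (proj t x))
  tendsto_atBot : ∀ x : H, Tendsto (fun s => proj s x) atBot (𝓝 0)
  tendsto_atTop : ∀ x : H, Tendsto (fun s => proj s x) atTop (𝓝 x)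

variable [CompleteSpace H]

/-- The distribution function `t ↦ ‖E t x‖² = ⟨E t x, x⟩`. -/
def SpectralFamily.stieltjes (E : SpectralFamily H) (x : H) : StieltjesFunction ℝ where
  toFun t := ‖E.proj t x‖ ^ 2
  mono' s t h := by
    have h1 : E.proj s x = E.proj s (E.proj t x) := by
      rw [← mul_apply_eq_comp, E.proj_mul s t h]
    have h2 : ‖E.proj s (E.proj t x)‖ ≤ 1 * ‖E.proj t x‖ :=
      (E.proj s).le_of_opNorm_le (E.isStarProjection s).norm_le _
    change ‖E.proj s x‖ ^ 2 ≤ ‖E.proj t x‖ ^ 2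
    rw [h1]
    gcongr
    simpa using h2
  right_continuous' t :=
    continuousWithinAt_Ioi_iff_Ici.mp ((E.right_continuous x t).norm.pow 2)

/-- The spectral measure `d⟨E t x, x⟩` of a vector `x`. -/
def SpectralFamily.measure (E : SpectralFamily H) (x : H) : Measure ℝ :=
  (E.stieltjes x).measure

/-- `S = ∫ t dE t`: the domain of `S` is `{x | ∫ t² d⟨E t x, x⟩ < ∞}`, and
`⟨S x, x⟩ = ∫ t d⟨E t x, x⟩` for `x` in the domain (which determines `S` by polarization). -/
def SpectralFamily.IsResolutionOf (E : SpectralFamily H) (S : H →ₗ.[ℂ] H) : Prop :=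
  (∀ x : H, x ∈ S.domain ↔ ∫⁻ t, ENNReal.ofReal (t ^ 2) ∂(E.measure x) < ∞) ∧
  ∀ x : S.domain, ⟪(x : H), S x⟫_ℂ = ((∫ t, t ∂(E.measure (x : H)) : ℝ) : ℂ)

open Classical in
/-- The orthogonal projection `P_t` onto the spectral subspace of a self-adjoint operator `S` for
the ray `(-∞, t]`: the value at `t` of the spectral family of `S`, which exists and is unique by
the spectral theorem. -/
def spectralProjection (S : H →ₗ.[ℂ] H) (t : ℝ) : H →L[ℂ] H :=
  if h : ∃ E : SpectralFamily H, E.IsResolutionOf S then h.choose.proj t else 0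

/-- The spectral counting function `N_τ(t; S) = Tr_τ P_t`. -/
def spectralCounting {A : Type*} [CStarAlgebra A] [PartialOrder A] [StarOrderedRing A]
    (τ : FiniteTrace A) [Module Aᵐᵒᵖ H] [AHilbertSpace τ H] (t : ℝ) (S : H →ₗ.[ℂ] H) : ℝ≥0∞ :=
  vnTrace τ (spectralProjection S t)

end Operators

end VN

end

/-!
Write `S = 𝒯²`; it is the diagonal operator with entries `T* T` and `T T*`.

The trace `Tr_τ` is unambiguous and behaves like a dimension because `Tr (B* B) = Tr (B B*)` for
bounded `A`-linear `B` (`traceIn_adjoint_comp_self`). Expanding `B` in matrix entries reduces this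
to operators `b` on `l²(A)` commuting with the right action, for which `‖b* 1‖ = ‖b 1‖`
(`norm_adjoint_apply_one`); the commutation theorem is not needed. It follows that a projection `p`
has `Tr p ≤ ∑ Tr (q k)` as soon as finitely many `A`-linear operators with ranges in those of the
projections `q k` are jointly injective on the range of `p`
(`vnTrace_le_sum_of_jointly_injective`); the square root of a bounded function of `∑ B k* B k`
takes the place of a polar decomposition.

The spectral projections in the statement come from the spectral theorem for unbounded operators.
The graph decomposition `H₁ ⊕ H₂ = {(x, T x)} ⊕ {(-T* y, y)}` shows that `S` is symmetric and
positive with `1 + S` onto (`isPositiveSelfAdjoint_square_offDiag`), and a resolution of such an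
operator is built from the resolvent `(1 + S)⁻¹` by continuous functional calculus and the
Riesz–Markov–Kakutani theorem (`IsPositiveSelfAdjoint.exists_resolution`). What is needed about
the projections is derived for an arbitrary resolution `E`: they reduce `S`, on the range of `E t`
the form of `S` is at most `t`, the kernel of `S` lies in this range and its orthogonal complement
in the image of `S`, and `E t` commutes with `A` (`SpectralFamily.IsResolutionOf.isALinear_proj`).

If `T` is Fredholm with `L ⊆ im T`, the open mapping theorem gives `C` with `‖x‖ ≤ C ‖T x‖` for `x`
orthogonal to the kernel with `T x ∈ L`, and `‖y‖ ≤ C ‖T* y‖` for `y ∈ L`. For `C² t < 1` a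
vector `(x, y)` of the spectral subspace, on which `‖T x‖² + ‖T* y‖² ≤ t (‖x‖² + ‖y‖²)`, vanishes
if `x ⊥ ker T`, `T x ∈ L` and `y ∈ L`; so its dimension is at most `dim ker T + 2 dim Lᗮ`.
Conversely, if `Tr (E t) < ∞`, the kernel of `T` embeds in the range of `E t`, and
`L = {y | E t (0, y) = 0}` lies in the image of `T` while `Lᗮ` embeds in the range of `E t`.
-/

noncomputable section

namespace VN

/-! ### The trace property of the von Neumann trace -/

theorem re_inner_self {E : Type*} [NormedAddCommGroup E] [InnerProductSpace ℂ E] (x : E) :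
    (⟪x, x⟫_ℂ).re = ‖x‖ ^ 2 :=
  inner_self_eq_norm_sq (𝕜 := ℂ) x

/-- Parseval's identity for a Hilbert sum decomposition. -/
theorem hasSum_norm_adjoint_sq {ι E : Type*} [NormedAddCommGroup E] [InnerProductSpace ℂ E]
    [CompleteSpace E] {G : ι → Type*} [∀ i, NormedAddCommGroup (G i)]
    [∀ i, InnerProductSpace ℂ (G i)] [∀ i, CompleteSpace (G i)] {V : ∀ i, G i →ₗᵢ[ℂ] E}
    (hV : IsHilbertSum ℂ G V) (w : E) :
    HasSum (fun i => ‖ContinuousLinearMap.adjoint (V i).toContinuousLinearMap w‖ ^ 2)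
      (‖w‖ ^ 2) := by
  classical
  set U := hV.linearIsometryEquiv
  have hU : ∀ i, (U w : ∀ i, G i) i =
      ContinuousLinearMap.adjoint (V i).toContinuousLinearMap w := by
    intro i
    refine ext_inner_left ℂ fun ξ => ?_
    rw [ContinuousLinearMap.adjoint_inner_right]
    have h1 : ⟪lp.single 2 i ξ, U w⟫_ℂ = ⟪ξ, (U w : ∀ i, G i) i⟫_ℂ :=
      lp.inner_single_left i ξ (U w)
    rw [← U.symm.inner_map_map, U.symm_apply_apply, hV.linearIsometryEquiv_symm_apply_single] at h1
    exact h1.symm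
  have h := Complex.hasSum_re (lp.hasSum_inner (𝕜 := ℂ) (U w) (U w))
  simp only [hU, U.inner_map_map, re_inner_self] at h
  exact h

section Trace

variable {A : Type*} [CStarAlgebra A] [PartialOrder A] [StarOrderedRing A] (τ : FiniteTrace A)

theorem denseRange_toL2 : DenseRange (toL2 τ) := by
  have h : DenseRange ((↑) : τ.functional.PreGNS → L2 τ) := Completion.denseRange_coe
  exact h.comp τ.functional.toPreGNS.surjective.denseRange (Completion.continuous_coe _)

theorem norm_toL2_star (a : A) : ‖toL2 τ (star a)‖ = ‖toL2 τ a‖ := by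
  simp only [toL2, Completion.norm_coe, norm_toPreGNS_star]

theorem inner_rightMul_left (a : A) (x y : L2 τ) :
    ⟪rightMul τ (star a) x, y⟫_ℂ = ⟪x, rightMul τ a y⟫_ℂ := by
  induction x using (denseRange_toL2 τ).induction_on with
  | hp => apply isClosed_eq <;> fun_prop
  | ih b =>
    induction y using (denseRange_toL2 τ).induction_on with
    | hp => apply isClosed_eq <;> fun_prop
    | ih c =>
      rw [rightMul_toL2, rightMul_toL2, inner_l2, inner_l2, star_mul, star_star, mul_assoc]

/-- An operator `b` of the commutant of the right action is determined by `b 1`, and `b* 1` is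
the image of `b 1` under the antiunitary extension of `a ↦ a*`. -/
theorem norm_adjoint_apply_one_le {b : L2 τ →L[ℂ] L2 τ}
    (hb : ∀ (a : A) x, b (rightMul τ a x) = rightMul τ a (b x)) :
    ‖ContinuousLinearMap.adjoint b (toL2 τ 1)‖ ≤ ‖b (toL2 τ 1)‖ := by
  set y := ContinuousLinearMap.adjoint b (toL2 τ 1) with hy
  have key : ∀ x : L2 τ, ‖⟪x, y⟫_ℂ‖ ≤ ‖b (toL2 τ 1)‖ * ‖x‖ := by
    intro x
    induction x using (denseRange_toL2 τ).induction_on with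
    | hp => apply isClosed_le <;> fun_prop
    | ih a =>
      have h1 : toL2 τ a = rightMul τ a (toL2 τ 1) := by rw [rightMul_toL2, one_mul]
      have h2 : rightMul τ (star a) (toL2 τ 1) = toL2 τ (star a) := by
        rw [rightMul_toL2, one_mul]
      rw [hy, ContinuousLinearMap.adjoint_inner_right, h1, hb]
      have := inner_rightMul_left τ (star a) (b (toL2 τ 1)) (toL2 τ 1)
      rw [star_star] at this
      rw [this, h2, ← h1, ← norm_toL2_star τ a]
      exact norm_inner_le_norm _ _
  have h := key y
  rw [inner_self_eq_norm_sq_to_K, norm_pow, RCLike.norm_ofReal, abs_norm, sq] at h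
  rcases (norm_nonneg y).eq_or_lt with h0 | h0
  · rw [← h0]; positivity
  · exact le_of_mul_le_mul_right h h0

theorem norm_adjoint_apply_one {b : L2 τ →L[ℂ] L2 τ}
    (hb : ∀ (a : A) x, b (rightMul τ a x) = rightMul τ a (b x)) :
    ‖ContinuousLinearMap.adjoint b (toL2 τ 1)‖ = ‖b (toL2 τ 1)‖ := by
  apply le_antisymm (norm_adjoint_apply_one_le τ hb)
  have hb' : ∀ (a : A) x, ContinuousLinearMap.adjoint b (rightMul τ a x) =
      rightMul τ a (ContinuousLinearMap.adjoint b x) := by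
    intro a x
    refine ext_inner_right ℂ fun y => ?_
    have h1 := inner_rightMul_left τ (star a)
    simp only [star_star] at h1
    rw [ContinuousLinearMap.adjoint_inner_left, h1, h1, ContinuousLinearMap.adjoint_inner_left, hb]
  simpa using norm_adjoint_apply_one_le τ hb'

variable {V : Type*} [NormedAddCommGroup V] [InnerProductSpace ℂ V]

/-- The isometry `ξ ↦ ξ ⊗ e j` of `l²(A)` into `l²(A) ⊗ V`. -/
def slice {ι : Type*} (e : HilbertBasis ι ℂ V) (j : ι) : L2 τ →ₗᵢ[ℂ] L2Tensor τ V where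
  toFun ξ := ((ξ ⊗ₜ[ℂ] e j : L2 τ ⊗[ℂ] V) : L2Tensor τ V)
  map_add' x y := by rw [TensorProduct.add_tmul, Completion.coe_add]
  map_smul' c x := by
    rw [← TensorProduct.smul_tmul', Completion.coe_smul, RingHom.id_apply]
  norm_map' x := by
    change ‖((x ⊗ₜ[ℂ] e j : L2 τ ⊗[ℂ] V) : L2Tensor τ V)‖ = ‖x‖
    rw [Completion.norm_coe, TensorProduct.norm_tmul, e.orthonormal.1, mul_one]

theorem slice_apply {ι : Type*} (e : HilbertBasis ι ℂ V) (j : ι) (ξ : L2 τ) :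
    slice τ e j ξ = ((ξ ⊗ₜ[ℂ] e j : L2 τ ⊗[ℂ] V) : L2Tensor τ V) := rfl

theorem slice_rightMul {ι : Type*} (e : HilbertBasis ι ℂ V) (j : ι) (a : A) (ξ : L2 τ) :
    slice τ e j (rightMul τ a ξ) = rightMulTensor τ V a (slice τ e j ξ) := by
  rw [slice_apply, slice_apply, rightMulTensor, ContinuousLinearMap.completion_apply_coe,
    ContinuousLinearMap.rTensor_tmul]

theorem inner_rightMulTensor_left (a : A) (x y : L2Tensor τ V) :
    ⟪rightMulTensor τ V (star a) x, y⟫_ℂ = ⟪x, rightMulTensor τ V a y⟫_ℂ := by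
  induction x, y using Completion.induction_on₂ with
  | hp => apply isClosed_eq <;> fun_prop
  | ih x y =>
    simp only [rightMulTensor, ContinuousLinearMap.completion_apply_coe, Completion.inner_coe]
    induction x using TensorProduct.induction_on with
    | zero => simp
    | add a b ha hb => rw [map_add, inner_add_left, ha, hb, inner_add_left]
    | tmul b v =>
      induction y using TensorProduct.induction_on with
      | zero => simp
      | add a b ha hb => rw [map_add, inner_add_right, ha, hb, inner_add_right]
      | tmul c w =>
        rw [ContinuousLinearMap.rTensor_tmul, ContinuousLinearMap.rTensor_tmul,
          TensorProduct.inner_tmul, TensorProduct.inner_tmul, inner_rightMul_left]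

theorem isHilbertSum_slice {ι : Type*} (e : HilbertBasis ι ℂ V) :
    IsHilbertSum ℂ (fun _ : ι => L2 τ) (slice τ e) := by
  refine IsHilbertSum.mk ?_ ?_
  · intro i j hij x y
    rw [slice_apply, slice_apply, Completion.inner_coe, TensorProduct.inner_tmul,
      e.orthonormal.2 hij, mul_zero]
  · rintro z -
    set M := (⨆ i, LinearMap.range (slice τ e i).toLinearMap).topologicalClosure with hM
    have hMc : IsClosed (M : Set (L2Tensor τ V)) := Submodule.isClosed_topologicalClosure _
    change z ∈ M
    induction z using Completion.induction_on with
    | hp => exact hMc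
    | ih z =>
      induction z using TensorProduct.induction_on with
      | zero => rw [Completion.coe_zero]; exact M.zero_mem
      | add a b ha hb => rw [Completion.coe_add]; exact M.add_mem ha hb
      | tmul ξ v =>
        have hcont : Continuous fun v : V => ((ξ ⊗ₜ[ℂ] v : L2 τ ⊗[ℂ] V) : L2Tensor τ V) :=
          (Completion.continuous_coe _).comp (TensorProduct.mkL ℂ (L2 τ) V ξ).continuous
        have hv : v ∈ (Submodule.span ℂ (Set.range e)).topologicalClosure := by
          rw [e.dense_span]; trivial
        refine closure_minimal (t := {v : V | ((ξ ⊗ₜ[ℂ] v : L2 τ ⊗[ℂ] V) : L2Tensor τ V) ∈ M})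
          ?_ (hMc.preimage hcont) hv
        intro w hw
        induction hw using Submodule.span_induction with
        | mem x h =>
          obtain ⟨j, rfl⟩ := h
          exact Submodule.le_topologicalClosure _ (Submodule.mem_iSup_of_mem j ⟨ξ, rfl⟩)
        | zero =>
          change ((ξ ⊗ₜ[ℂ] (0 : V) : L2 τ ⊗[ℂ] V) : L2Tensor τ V) ∈ M
          rw [TensorProduct.tmul_zero, Completion.coe_zero]; exact M.zero_mem
        | add x y _ _ hx hy =>
          change ((ξ ⊗ₜ[ℂ] (x + y) : L2 τ ⊗[ℂ] V) : L2Tensor τ V) ∈ M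
          rw [TensorProduct.tmul_add, Completion.coe_add]; exact M.add_mem hx hy
        | smul c x _ hx =>
          change ((ξ ⊗ₜ[ℂ] (c • x) : L2 τ ⊗[ℂ] V) : L2Tensor τ V) ∈ M
          rw [TensorProduct.tmul_smul, Completion.coe_smul]; exact M.smul_mem c hx

/-- Parseval's identity for the decomposition of `l²(A) ⊗ V` into the slices `l²(A) ⊗ e j`. -/
theorem tsum_norm_adjoint_slice_sq {ι : Type*} (e : HilbertBasis ι ℂ V) (w : L2Tensor τ V) :
    ∑' j, ENNReal.ofReal
      (‖ContinuousLinearMap.adjoint (slice τ e j).toContinuousLinearMap w‖ ^ 2) =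
      ENNReal.ofReal (‖w‖ ^ 2) := by
  have h := hasSum_norm_adjoint_sq (isHilbertSum_slice τ e) w
  rw [← h.tsum_eq, ENNReal.ofReal_tsum_of_nonneg (fun _ => by positivity) h.summable]

open ContinuousLinearMap in
/-- The trace property of `τ ⊗ Tr` for an operator `C : l²(A) ⊗ V → l²(A) ⊗ V'` commuting with
the right action: expand both sides in the matrix entries of `C`, which are operators on `l²(A)`
commuting with the right action. -/
theorem tsum_norm_sq_eq_tsum_norm_adjoint_sq [CompleteSpace V] {V' : Type*}
    [NormedAddCommGroup V'] [InnerProductSpace ℂ V'] [CompleteSpace V'] {ι ι' : Type*}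
    (e : HilbertBasis ι ℂ V) (e' : HilbertBasis ι' ℂ V') {C : L2Tensor τ V →L[ℂ] L2Tensor τ V'}
    (hC : ∀ (a : A) x, C (rightMulTensor τ V a x) = rightMulTensor τ V' a (C x)) :
    ∑' j, ENNReal.ofReal (‖C (slice τ e j (toL2 τ 1))‖ ^ 2) =
      ∑' k, ENNReal.ofReal (‖adjoint C (slice τ e' k (toL2 τ 1))‖ ^ 2) := by
  simp_rw [← tsum_norm_adjoint_slice_sq τ e', ← tsum_norm_adjoint_slice_sq τ e]
  rw [ENNReal.tsum_comm]
  refine tsum_congr fun k => tsum_congr fun j => ?_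
  set b : L2 τ →L[ℂ] L2 τ := adjoint (slice τ e' k).toContinuousLinearMap ∘L C ∘L
    (slice τ e j).toContinuousLinearMap with hb
  have hcomm : ∀ (a : A) x, b (rightMul τ a x) = rightMul τ a (b x) := by
    intro a x
    refine ext_inner_left ℂ fun y => ?_
    simp only [hb, comp_apply, LinearIsometry.coe_toContinuousLinearMap]
    rw [← inner_rightMul_left, adjoint_inner_right, adjoint_inner_right,
      LinearIsometry.coe_toContinuousLinearMap, slice_rightMul, slice_rightMul, hC,
      inner_rightMulTensor_left]
  have h := norm_adjoint_apply_one τ hcomm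
  have hadj : adjoint b = adjoint (slice τ e j).toContinuousLinearMap ∘L adjoint C ∘L
      (slice τ e' k).toContinuousLinearMap := by
    rw [hb, adjoint_comp, adjoint_comp, adjoint_adjoint, comp_assoc]
  rw [hadj] at h
  exact congrArg (fun t : ℝ => ENNReal.ofReal (t ^ 2)) h.symm

end Trace

section ALinear

/-- A bounded operator `B` is `A`-linear if `B (x a) = (B x) a` for all `a` in `A`. -/
def IsALinear (A : Type*) [CStarAlgebra A] {H H' : Type*} [NormedAddCommGroup H]
    [InnerProductSpace ℂ H] [Module Aᵐᵒᵖ H] [NormedAddCommGroup H'] [InnerProductSpace ℂ H']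
    [Module Aᵐᵒᵖ H'] (B : H →L[ℂ] H') : Prop :=
  ∀ (a : A) (x : H), B (MulOpposite.op a • x) = MulOpposite.op a • B x

theorem IsALinear.comp {A : Type*} [CStarAlgebra A] {H H' H'' : Type*} [NormedAddCommGroup H]
    [InnerProductSpace ℂ H] [Module Aᵐᵒᵖ H] [NormedAddCommGroup H'] [InnerProductSpace ℂ H']
    [Module Aᵐᵒᵖ H'] [NormedAddCommGroup H''] [InnerProductSpace ℂ H''] [Module Aᵐᵒᵖ H'']
    {B : H' →L[ℂ] H''} {C : H →L[ℂ] H'} (hB : IsALinear A B) (hC : IsALinear A C) :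
    IsALinear A (B ∘L C) := fun a x => by
  rw [ContinuousLinearMap.comp_apply, hC, hB, ContinuousLinearMap.comp_apply]

variable {A : Type*} [CStarAlgebra A] [PartialOrder A] [StarOrderedRing A] (τ : FiniteTrace A)
  {H H' : Type*} [NormedAddCommGroup H] [InnerProductSpace ℂ H] [CompleteSpace H]
  [Module Aᵐᵒᵖ H] [NormedAddCommGroup H'] [InnerProductSpace ℂ H'] [CompleteSpace H']
  [Module Aᵐᵒᵖ H']

theorem IsALinear.adjoint [h : AHilbertSpace τ H] [h' : AHilbertSpace τ H'] {B : H →L[ℂ] H'}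
    (hB : IsALinear A B) : IsALinear A (ContinuousLinearMap.adjoint B) := fun a x => by
  refine ext_inner_left ℂ fun y => ?_
  rw [ContinuousLinearMap.adjoint_inner_right, ← h.compatible, ← h'.compatible,
    ContinuousLinearMap.adjoint_inner_right, hB]

open ContinuousLinearMap in
theorem traceIn_eq (i : AEmbedding τ H) {ι : Type} (e : HilbertBasis ι ℂ i.V) (P : H →L[ℂ] H) :
    traceIn τ i e P = ∑' j, ENNReal.ofReal
      (⟪adjoint i.emb.toContinuousLinearMap (slice τ e j (toL2 τ 1)),
        P (adjoint i.emb.toContinuousLinearMap (slice τ e j (toL2 τ 1)))⟫_ℂ).re := by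
  refine tsum_congr fun j => ?_
  rw [adjoint_inner_left]
  rfl

open ContinuousLinearMap in
/-- `Tr (B* B) = Tr (B B*)` for a bounded `A`-linear `B : H → H'`, whatever embeddings and bases
are used to compute the two traces. -/
theorem traceIn_adjoint_comp_self [h : AHilbertSpace τ H] [AHilbertSpace τ H']
    (i : AEmbedding τ H) {ι : Type} (e : HilbertBasis ι ℂ i.V)
    (i' : AEmbedding τ H') {ι' : Type} (e' : HilbertBasis ι' ℂ i'.V)
    {B : H →L[ℂ] H'} (hB : IsALinear A B) :
    traceIn τ i e (adjoint B ∘L B) = traceIn τ i' e' (B ∘L adjoint B) := by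
  have hi : ∀ (a : A) x, adjoint i.emb.toContinuousLinearMap (rightMulTensor τ i.V a x) =
      MulOpposite.op a • adjoint i.emb.toContinuousLinearMap x := by
    intro a x
    refine ext_inner_left ℂ fun y => ?_
    rw [adjoint_inner_right, ← h.compatible, adjoint_inner_right, ← inner_rightMulTensor_left]
    simp only [LinearIsometry.coe_toContinuousLinearMap, i.emb_smul]
  set C := i'.emb.toContinuousLinearMap ∘L B ∘L adjoint i.emb.toContinuousLinearMap with hC
  have hadj : adjoint C =
      i.emb.toContinuousLinearMap ∘L adjoint B ∘L adjoint i'.emb.toContinuousLinearMap := by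
    rw [hC, adjoint_comp, adjoint_comp, adjoint_adjoint, comp_assoc]
  have key := tsum_norm_sq_eq_tsum_norm_adjoint_sq τ e e' (C := C) (fun a x => by
    simp only [hC, comp_apply, hi, hB a, LinearIsometry.coe_toContinuousLinearMap, i'.emb_smul])
  rw [hadj] at key
  simp only [hC, comp_apply, LinearIsometry.coe_toContinuousLinearMap,
    LinearIsometry.norm_map] at key
  rw [traceIn_eq, traceIn_eq]
  simp only [comp_apply]
  simp_rw [adjoint_inner_right, re_inner_self]
  rw [key]
  refine tsum_congr fun k => ?_
  rw [← adjoint_inner_left, re_inner_self]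

open ContinuousLinearMap in
theorem vnTrace_adjoint_comp_self [AHilbertSpace τ H] [AHilbertSpace τ H']
    {B : H →L[ℂ] H'} (hB : IsALinear A B) :
    vnTrace τ (adjoint B ∘L B) = vnTrace τ (B ∘L adjoint B) :=
  traceIn_adjoint_comp_self τ _ _ _ _ hB

variable [AHilbertSpace τ H]

theorem vnTrace_mono {P Q : H →L[ℂ] H} (h : ∀ x, (⟪x, P x⟫_ℂ).re ≤ (⟪x, Q x⟫_ℂ).re) :
    vnTrace τ P ≤ vnTrace τ Q := by
  rw [vnTrace, vnTrace, traceIn_eq, traceIn_eq]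
  exact ENNReal.tsum_le_tsum fun j => ENNReal.ofReal_le_ofReal (h _)

theorem vnTrace_sum {κ : Type*} (s : Finset κ) {P : κ → H →L[ℂ] H}
    (h : ∀ k x, 0 ≤ (⟪x, P k x⟫_ℂ).re) :
    vnTrace τ (∑ k ∈ s, P k) = ∑ k ∈ s, vnTrace τ (P k) := by
  simp only [vnTrace, traceIn_eq]
  rw [← Summable.tsum_finsetSum fun _ _ => ENNReal.summable]
  refine tsum_congr fun j => ?_
  rw [← ENNReal.ofReal_sum_of_nonneg fun k _ => h k _, _root_.sum_apply, inner_sum,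
    Complex.re_sum]

/-- Lower semicontinuity of the trace for strong convergence. -/
theorem vnTrace_le_of_tendsto {P : ℕ → H →L[ℂ] H} {Q : H →L[ℂ] H}
    (h : ∀ x, Tendsto (fun n => P n x) atTop (𝓝 (Q x))) {c : ℝ≥0∞}
    (hc : ∀ n, vnTrace τ (P n) ≤ c) : vnTrace τ Q ≤ c := by
  simp only [vnTrace, traceIn_eq] at hc ⊢
  rw [ENNReal.tsum_eq_iSup_sum]
  refine iSup_le fun s => le_of_tendsto (x := atTop)
    (tendsto_finsetSum s fun j _ => ?_) (Eventually.of_forall fun n =>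
      (ENNReal.sum_le_tsum s).trans (hc n))
  exact ENNReal.tendsto_ofReal ((Complex.continuous_re.tendsto _).comp
    (tendsto_const_nhds.inner (h _)))

end ALinear

/-! ### Comparison of dimensions -/

section Resolvent

variable {H : Type*} [NormedAddCommGroup H] [InnerProductSpace ℂ H] [CompleteSpace H]

/-- `(1 + (n + 1) C)⁻¹`, as a function of the positive operator `C`. -/
def damping (n : ℕ) (C : H →L[ℂ] H) : H →L[ℂ] H := cfc (fun t : ℝ => (1 + ((n : ℝ) + 1) * t)⁻¹) C

theorem continuousOn_damping {C : H →L[ℂ] H} (hC : 0 ≤ C) (n : ℕ) :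
    ContinuousOn (fun t : ℝ => (1 + ((n : ℝ) + 1) * t)⁻¹) (spectrum ℝ C) := by
  refine ContinuousOn.inv₀ (by fun_prop) fun t ht => ?_
  have := spectrum_nonneg_of_nonneg hC ht
  positivity

theorem norm_damping_le {C : H →L[ℂ] H} (hC : 0 ≤ C) (n : ℕ) : ‖damping n C‖ ≤ 1 := by
  refine norm_cfc_le zero_le_one fun t ht => ?_
  have := spectrum_nonneg_of_nonneg hC ht
  rw [Real.norm_of_nonneg (by positivity)]
  exact inv_le_one_of_one_le₀ (by nlinarith [mul_nonneg (n.cast_nonneg (α := ℝ)) this])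

theorem damping_mul_self {C : H →L[ℂ] H} (hC : 0 ≤ C) (n : ℕ) :
    damping n C * C = cfc (fun t : ℝ => (1 + ((n : ℝ) + 1) * t)⁻¹ * t) C := by
  have hsa : IsSelfAdjoint C := .of_nonneg hC
  rw [cfc_mul _ _ C (continuousOn_damping hC n), cfc_id' ℝ C, damping]

theorem norm_damping_mul_self_le {C : H →L[ℂ] H} (hC : 0 ≤ C) (n : ℕ) :
    ‖damping n C * C‖ ≤ 1 / ((n : ℝ) + 1) := by
  rw [damping_mul_self hC]
  refine norm_cfc_le (by positivity) fun t ht => ?_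
  have := spectrum_nonneg_of_nonneg hC ht
  rw [Real.norm_of_nonneg (by positivity), inv_mul_eq_div, div_le_div_iff₀ (by positivity)
    (by positivity)]
  linarith

theorem damping_add_smul {C : H →L[ℂ] H} (hC : 0 ≤ C) (n : ℕ) :
    damping n C + ((n : ℝ) + 1) • (damping n C * C) = 1 := by
  have hsa : IsSelfAdjoint C := .of_nonneg hC
  have hc : ContinuousOn (fun t : ℝ => (1 + ((n : ℝ) + 1) * t)⁻¹ * t) (spectrum ℝ C) :=
    (continuousOn_damping hC n).mul continuousOn_id
  have hc' : ContinuousOn (fun t : ℝ => ((n : ℝ) + 1) • ((1 + ((n : ℝ) + 1) * t)⁻¹ * t))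
      (spectrum ℝ C) := hc.const_smul ((n : ℝ) + 1)
  rw [damping_mul_self hC, ← cfc_smul _ _ C hc, damping,
    ← cfc_add (R := ℝ) (a := C) (f := fun t : ℝ => (1 + ((n : ℝ) + 1) * t)⁻¹)
      (g := fun t : ℝ => ((n : ℝ) + 1) • ((1 + ((n : ℝ) + 1) * t)⁻¹ * t))
      (continuousOn_damping hC n) hc', ← cfc_one ℝ C]
  refine cfc_congr fun t ht => ?_
  have := spectrum_nonneg_of_nonneg hC ht
  have h1 : 1 + ((n : ℝ) + 1) * t ≠ 0 := by positivity
  simp only [smul_eq_mul, Pi.one_apply]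
  field_simp

/-- `(1 + n C)⁻¹` converges strongly to the projection onto the kernel of `C`: it fixes the
kernel, and tends to `0` on the range, hence on its closure. -/
theorem tendsto_damping {C : H →L[ℂ] H} (hC : 0 ≤ C) (x : H) :
    Tendsto (fun n => damping n C x) atTop (𝓝 (C.ker.starProjection x)) := by
  have hsa : IsSelfAdjoint C := .of_nonneg hC
  have hker : ∀ y ∈ C.ker, ∀ n, damping n C y = y := by
    intro y hy n
    have h := congrArg (fun B : H →L[ℂ] H => B y) (damping_add_smul hC n)
    have hy' : C y = 0 := hy
    simpa [hy'] using h
  have hort : ∀ z ∈ C.kerᗮ, Tendsto (fun n => damping n C z) atTop (𝓝 0) := by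
    intro z hz
    rw [ContinuousLinearMap.orthogonal_ker, hsa.adjoint_eq] at hz
    rw [Metric.tendsto_atTop]
    intro ε hε
    obtain ⟨_, ⟨w, rfl⟩, hw⟩ := Metric.mem_closure_iff.1 hz (ε / 2) (half_pos hε)
    have hw0 : Tendsto (fun n : ℕ => 1 / ((n : ℝ) + 1) * ‖w‖) atTop (𝓝 0) := by
      simpa using tendsto_one_div_add_atTop_nhds_zero_nat.mul_const ‖w‖
    obtain ⟨N, hN⟩ := (hw0.eventually (gt_mem_nhds (half_pos hε))).exists_forall_of_atTop
    refine ⟨N, fun n hn => ?_⟩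
    have h1 : ‖damping n C (z - C w)‖ ≤ ‖z - C w‖ := by
      simpa using (damping n C).le_of_opNorm_le (norm_damping_le hC n) (z - C w)
    have h2 : ‖damping n C (C w)‖ ≤ 1 / ((n : ℝ) + 1) * ‖w‖ :=
      (damping n C * C).le_of_opNorm_le (norm_damping_mul_self_le hC n) w
    have h3 := hN n hn
    have h4 : ‖z - C w‖ < ε / 2 := by rw [← dist_eq_norm]; exact hw
    rw [dist_zero_right]
    calc ‖damping n C z‖ = ‖damping n C (z - C w) + damping n C (C w)‖ := by
          rw [← map_add, sub_add_cancel]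
      _ ≤ _ := norm_add_le _ _
      _ < ε := by linarith
  have hx : ∀ n, damping n C x = C.ker.starProjection x +
      damping n C (x - C.ker.starProjection x) := by
    intro n
    rw [map_sub, hker _ (Submodule.starProjection_apply_mem _ x)]
    abel
  simp_rw [hx]
  simpa using (hort _ (Submodule.sub_starProjection_mem_orthogonal x)).const_add
    (C.ker.starProjection x)

end Resolvent

section Dimension

theorem _root_.IsStarProjection.re_inner_self_apply {H : Type*} [NormedAddCommGroup H]
    [InnerProductSpace ℂ H] [CompleteSpace H] {q : H →L[ℂ] H} (hq : IsStarProjection q) (x : H) :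
    (⟪x, q x⟫_ℂ).re = ‖q x‖ ^ 2 := by
  rw [← re_inner_self, ← ContinuousLinearMap.adjoint_inner_right, hq.isSelfAdjoint.adjoint_eq,
    ← mul_apply_eq_comp, hq.isIdempotentElem.eq]

theorem IsALinear.sum {A : Type*} [CStarAlgebra A] {H H' : Type*} [NormedAddCommGroup H]
    [InnerProductSpace ℂ H] [Module Aᵐᵒᵖ H] [NormedAddCommGroup H'] [InnerProductSpace ℂ H']
    [Module Aᵐᵒᵖ H'] {κ : Type*} (s : Finset κ) {C : κ → H →L[ℂ] H'}
    (h : ∀ k, IsALinear A (C k)) : IsALinear A (∑ k ∈ s, C k) := fun a x => by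
  simp only [_root_.sum_apply, Finset.smul_sum, h _ a]

variable {A : Type*} [CStarAlgebra A] [PartialOrder A] [StarOrderedRing A] (τ : FiniteTrace A)
  {H H' : Type*} [NormedAddCommGroup H] [InnerProductSpace ℂ H] [CompleteSpace H]
  [Module Aᵐᵒᵖ H] [NormedAddCommGroup H'] [InnerProductSpace ℂ H']
  [CompleteSpace H'] [Module Aᵐᵒᵖ H']

/-- The action of an element of `A` on an `A`-Hilbert space is a bounded operator. -/
theorem exists_continuousLinearMap_smul (H : Type*) [NormedAddCommGroup H] [InnerProductSpace ℂ H]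
    [CompleteSpace H] [Module Aᵐᵒᵖ H] [h : AHilbertSpace τ H] (a : A) :
    ∃ R : H →L[ℂ] H, ∀ x, R x = MulOpposite.op a • x := by
  obtain ⟨i⟩ := h.exists_embedding
  refine ⟨ContinuousLinearMap.adjoint i.emb.toContinuousLinearMap ∘L rightMulTensor τ i.V a ∘L
    i.emb.toContinuousLinearMap, fun x => ?_⟩
  refine ext_inner_left ℂ fun y => ?_
  rw [ContinuousLinearMap.comp_apply, ContinuousLinearMap.adjoint_inner_right]
  simp only [ContinuousLinearMap.comp_apply, LinearIsometry.coe_toContinuousLinearMap]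
  rw [← i.emb_smul, i.emb.inner_map_map]

theorem IsALinear.cfc [AHilbertSpace τ H] {C : H →L[ℂ] H} (hC : IsALinear A C) (f : ℝ → ℝ) :
    IsALinear A (cfc f C) := fun a x => by
  obtain ⟨R, hR⟩ := exists_continuousLinearMap_smul τ H a
  have h : Commute C R := by
    ext y
    simp only [mul_apply_eq_comp, hR]
    exact hC a y
  have := congrArg (fun B : H →L[ℂ] H => B x) (h.cfc_real f).eq
  simpa only [mul_apply_eq_comp, hR] using this

open ContinuousLinearMap in
/-- If `A`-linear operators `B k`, with ranges in those of the projections `q k`, are jointly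
injective on the range of the projection `p`, then `Tr p ≤ ∑ Tr (q k)`. For `C = ∑ B k* B k`,
the operators `X k = B k ((n + 1) / (1 + (n + 1) C)) ^ (1 / 2)` satisfy `X k X k* ≤ q k`, while
`∑ X k* X k = 1 - (1 + (n + 1) C)⁻¹` converges strongly to the projection onto the orthogonal
complement of the kernel of `C`, which dominates `p`. -/
theorem vnTrace_le_sum_of_jointly_injective [AHilbertSpace τ H] [AHilbertSpace τ H'] {κ : Type*} (s : Finset κ) {B : κ → H →L[ℂ] H'}
    {q : κ → H' →L[ℂ] H'} {p : H →L[ℂ] H} (hB : ∀ k, IsALinear A (B k))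
    (hq : ∀ k, IsStarProjection (q k)) (hp : IsStarProjection p) (hqB : ∀ k x, q k (B k x) = B k x)
    (hinj : ∀ x, (∀ k ∈ s, B k x = 0) → p x = 0) :
    vnTrace τ p ≤ ∑ k ∈ s, vnTrace τ (q k) := by
  set C : H →L[ℂ] H := ∑ k ∈ s, adjoint (B k) ∘L B k with hCdef
  have hCx : ∀ x, (⟪x, C x⟫_ℂ).re = ∑ k ∈ s, ‖B k x‖ ^ 2 := by
    intro x
    simp only [hCdef, _root_.sum_apply, inner_sum, Complex.re_sum, comp_apply,
      adjoint_inner_right, re_inner_self]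
  have hC : 0 ≤ C := by
    rw [nonneg_iff_isPositive]
    have : ∀ k, (adjoint (B k) ∘L B k).IsPositive := fun k => isPositive_adjoint_comp_self (B k)
    exact (nonneg_iff_isPositive _).1
      (Finset.sum_nonneg fun k _ => (nonneg_iff_isPositive _).2 (this k))
  have hsa : IsSelfAdjoint C := .of_nonneg hC
  have hCA : IsALinear A C := IsALinear.sum s fun k => ((hB k).adjoint τ).comp (hB k)
  have hker : ∀ x, C x = 0 → p x = 0 := by
    intro x hx
    refine hinj x fun k hk => ?_
    have h := hCx x
    rw [hx, inner_zero_right, Complex.zero_re, eq_comm,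
      Finset.sum_eq_zero_iff_of_nonneg fun _ _ => by positivity] at h
    simpa using h k hk
  have hpQ : vnTrace τ p ≤ vnTrace τ (1 - C.ker.starProjection) := by
    refine vnTrace_mono τ fun x => ?_
    have hQ : IsStarProjection (1 - C.ker.starProjection) :=
      (isStarProjection_starProjection (U := C.ker)).one_sub
    rw [hp.re_inner_self_apply, hQ.re_inner_self_apply]
    have h1 : p x = p ((1 - C.ker.starProjection) x) := by
      have : p (C.ker.starProjection x) = 0 :=
        hker _ (C.ker.starProjection_apply_mem x)
      rw [_root_.sub_apply, one_apply_eq_self, map_sub, this, sub_zero]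
    rw [h1]
    gcongr
    simpa using p.le_of_opNorm_le hp.norm_le ((1 - C.ker.starProjection) x)
  refine hpQ.trans (vnTrace_le_of_tendsto τ (P := fun n => 1 - damping n C)
    (fun x => (tendsto_damping hC x).const_sub x) fun n => ?_)
  have hcont : ContinuousOn (fun t : ℝ => √(((n : ℝ) + 1) * (1 + ((n : ℝ) + 1) * t)⁻¹))
      (spectrum ℝ C) :=
    (continuousOn_const.mul (continuousOn_damping hC n)).sqrt
  set R : H →L[ℂ] H := cfc (fun t : ℝ => √(((n : ℝ) + 1) * (1 + ((n : ℝ) + 1) * t)⁻¹)) C with hR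
  have hRsa : adjoint R = R := (cfc_predicate (p := IsSelfAdjoint) _ C).adjoint_eq
  have hRCR : R * C * R = 1 - damping n C := by
    have hcomm : C * R = R * C := ((Commute.refl C).cfc_real _).eq.symm
    have hRR : R * R = ((n : ℝ) + 1) • damping n C := by
      rw [hR, ← cfc_mul _ _ C hcont hcont, damping, ← cfc_smul _ _ C (continuousOn_damping hC n)]
      refine cfc_congr fun t ht => ?_
      have := spectrum_nonneg_of_nonneg hC ht
      exact Real.mul_self_sqrt (by positivity)
    rw [mul_assoc, hcomm, ← mul_assoc, hRR, smul_mul_assoc, eq_sub_iff_add_eq',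
      damping_add_smul hC]
  set X : κ → H →L[ℂ] H' := fun k => B k ∘L R with hX
  have hsum : 1 - damping n C = ∑ k ∈ s, adjoint (X k) ∘L X k := by
    rw [← hRCR]
    ext x
    simp only [hX, hCdef, adjoint_comp, hRsa, mul_apply_eq_comp, comp_apply, _root_.sum_apply, map_sum]
  have hRA : IsALinear A R := hCA.cfc τ _
  have hXA : ∀ k, IsALinear A (X k) := fun k => (hB k).comp hRA
  have hXle : ∀ k ∈ s, ‖X k‖ ≤ 1 := by
    intro k hk
    refine opNorm_le_bound _ zero_le_one fun x => ?_
    rw [one_mul, ← sq_le_sq₀ (norm_nonneg _) (norm_nonneg _)]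
    have h1 : ∑ j ∈ s, ‖X j x‖ ^ 2 = (⟪x, (1 - damping n C) x⟫_ℂ).re := by
      simp only [hsum, _root_.sum_apply, inner_sum, Complex.re_sum, comp_apply,
        adjoint_inner_right, re_inner_self]
    have h2 : 0 ≤ damping n C := cfc_nonneg fun t ht => by
      have := spectrum_nonneg_of_nonneg hC ht
      positivity
    have h3 : 0 ≤ (⟪x, damping n C x⟫_ℂ).re :=
      ((nonneg_iff_isPositive _).1 h2).re_inner_nonneg_right x
    calc ‖X k x‖ ^ 2 ≤ ∑ j ∈ s, ‖X j x‖ ^ 2 :=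
          Finset.single_le_sum (f := fun j => ‖X j x‖ ^ 2) (fun _ _ => by positivity) hk
      _ ≤ ‖x‖ ^ 2 := by
          rw [h1, _root_.sub_apply, one_apply_eq_self, inner_sub_right, Complex.sub_re, re_inner_self]
          linarith
  change vnTrace τ (1 - damping n C) ≤ _
  rw [hsum, vnTrace_sum τ s fun k x => by
    rw [comp_apply, adjoint_inner_right, re_inner_self]; positivity]
  refine Finset.sum_le_sum fun k hk => ?_
  rw [vnTrace_adjoint_comp_self τ (hXA k)]
  refine vnTrace_mono τ fun y => ?_
  have h1 : adjoint (X k) y = adjoint (X k) (q k y) := by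
    refine ext_inner_right ℂ fun z => ?_
    rw [adjoint_inner_left, adjoint_inner_left, ← adjoint_inner_right,
      (hq k).isSelfAdjoint.adjoint_eq]
    exact congrArg _ (hqB k (R z)).symm
  rw [comp_apply, ← adjoint_inner_left, re_inner_self, (hq k).re_inner_self_apply, h1]
  gcongr
  have := (adjoint (X k)).le_of_opNorm_le (c := 1) (by
    rw [LinearIsometryEquiv.norm_map]; exact hXle k hk) (q k y)
  simpa using this

end Dimension

/-! ### Spectral measures of bounded self-adjoint operators -/

section SpectralMeasure

variable {H : Type*} [NormedAddCommGroup H] [InnerProductSpace ℂ H] [CompleteSpace H]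

/-- `ν` is the spectral measure of the vector `x` for the bounded self-adjoint operator `G`: it
represents the functional `f ↦ ⟨x, f(G) x⟩`. -/
structure IsSpectralMeasure (G : H →L[ℂ] H) (x : H) (ν : Measure ℝ) : Prop where
  finite : IsFiniteMeasure ν
  ae_mem : ∀ᵐ s ∂ν, s ∈ spectrum ℝ G
  integral_eq : ∀ f : ℝ → ℝ, ContinuousOn f (spectrum ℝ G) → ∫ s, f s ∂ν = (⟪x, cfc f G x⟫_ℂ).re

theorem exists_isSpectralMeasure {G : H →L[ℂ] H} (hG : IsSelfAdjoint G) (x : H) :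
    ∃ ν, IsSpectralMeasure G x ν := by
  let Λ₀ : CompactlySupportedContinuousMap (spectrum ℝ G) ℝ →ₗ[ℝ] ℝ :=
    { toFun := fun f => (⟪x, cfcHom (R := ℝ) hG f.toContinuousMap x⟫_ℂ).re
      map_add' := fun f g => by
        have : (f + g).toContinuousMap = f.toContinuousMap + g.toContinuousMap := rfl
        rw [this, map_add, _root_.add_apply, inner_add_right, Complex.add_re]
      map_smul' := fun c f => by
        have : (c • f).toContinuousMap = c • f.toContinuousMap := rfl
        rw [this, map_smul, _root_.smul_apply, ← Complex.coe_smul, inner_smul_right,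
          Complex.re_ofReal_mul, RingHom.id_apply, smul_eq_mul] }
  let Λ : CompactlySupportedContinuousMap (spectrum ℝ G) ℝ →ₚ[ℝ] ℝ :=
    PositiveLinearMap.mk₀ Λ₀ fun f hf => by
      have h : 0 ≤ cfcHom (R := ℝ) hG f.toContinuousMap := (cfcHom_nonneg_iff hG).2 hf
      exact ((ContinuousLinearMap.nonneg_iff_isPositive _).1 h).re_inner_nonneg_right x
  refine ⟨(RealRMK.rieszMeasure Λ).map Subtype.val, inferInstance, ?_, fun f hf => ?_⟩
  · have hm : MeasurableSet {s : ℝ | s ∈ spectrum ℝ G} :=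
      (spectrum.isClosed (𝕜 := ℝ) G).measurableSet
    exact (ae_map_iff measurable_subtype_coe.aemeasurable hm).2 (Eventually.of_forall fun s => s.2)
  · let g : CompactlySupportedContinuousMap (spectrum ℝ G) ℝ :=
      ⟨⟨_, hf.domRestrict⟩, HasCompactSupport.of_compactSpace _⟩
    have h := RealRMK.integral_rieszMeasure Λ g
    have hme : MeasurableEmbedding (Subtype.val : spectrum ℝ G → ℝ) :=
      MeasurableEmbedding.subtype_coe (spectrum.isClosed (𝕜 := ℝ) G).measurableSet
    rw [hme.integral_map, cfc_apply f G hG hf]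
    exact h

variable {G : H →L[ℂ] H} {x : H} {ν : Measure ℝ}

theorem IsSpectralMeasure.integrable (hν : IsSpectralMeasure G x ν) {f : ℝ → ℝ}
    (hf : ContinuousOn f (spectrum ℝ G)) : Integrable f ν := by
  have := hν.finite
  have hr : ν.restrict (spectrum ℝ G) = ν := Measure.restrict_eq_self_of_ae_mem hν.ae_mem
  rw [← hr]
  exact hf.integrableOn_compact (ContinuousFunctionalCalculus.isCompact_spectrum G)

theorem IsSpectralMeasure.norm_cfc_apply_sq (hG : IsSelfAdjoint G) (hν : IsSpectralMeasure G x ν)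
    {f : ℝ → ℝ} (hf : ContinuousOn f (spectrum ℝ G)) :
    ‖cfc f G x‖ ^ 2 = ∫ s, f s ^ 2 ∂ν := by
  rw [hν.integral_eq (fun s => f s ^ 2) (hf.pow 2), cfc_pow f 2 G hf, sq (cfc f G), mul_apply_eq_comp,
    ← ContinuousLinearMap.adjoint_inner_left,
    (cfc_predicate (p := IsSelfAdjoint) f G).adjoint_eq, re_inner_self]

theorem IsSpectralMeasure.real_univ (hG : IsSelfAdjoint G) (hν : IsSpectralMeasure G x ν) :
    ν.real Set.univ = ‖x‖ ^ 2 := by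
  have h := hν.integral_eq (fun _ => 1) continuousOn_const
  rw [cfc_const_one ℝ G, one_apply_eq_self, re_inner_self] at h
  rw [← h, integral_const, smul_eq_mul, mul_one]

/-- The projection onto the kernel of `h(G)` is the spectral projection for `{h = 0}`: it is the
strong limit of `(1 + n h(G))⁻¹`, and `(1 + n h)⁻¹` decreases to the indicator of `{h = 0}`. -/
theorem IsSpectralMeasure.norm_starProjection_ker_sq (hG : IsSelfAdjoint G)
    (hν : IsSpectralMeasure G x ν) {h : ℝ → ℝ} (hc : Continuous h)
    (h0 : ∀ s ∈ spectrum ℝ G, 0 ≤ h s) :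
    ‖(cfc h G).ker.starProjection x‖ ^ 2 = ν.real {s | h s = 0} := by
  have := hν.finite
  have hpos : 0 ≤ cfc h G := cfc_nonneg h0
  have hdamp : ∀ n, damping n (cfc h G) = cfc (fun s => (1 + ((n : ℝ) + 1) * h s)⁻¹) G := by
    intro n
    have h1 := continuousOn_damping hpos n
    rw [cfc_map_spectrum h G] at h1
    rw [damping, ← cfc_comp' (fun t : ℝ => (1 + ((n : ℝ) + 1) * t)⁻¹) h G h1 hc.continuousOn]
  have hden : ∀ n : ℕ, ∀ s ∈ spectrum ℝ G, 1 ≤ 1 + ((n : ℝ) + 1) * h s := fun n s hs => by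
    have := h0 s hs
    have : 0 ≤ ((n : ℝ) + 1) * h s := by positivity
    linarith
  have hcont : ∀ n : ℕ, ContinuousOn (fun s => (1 + ((n : ℝ) + 1) * h s)⁻¹) (spectrum ℝ G) := by
    intro n
    exact ContinuousOn.inv₀ (by fun_prop) fun s hs => by linarith [hden n s hs]
  have hlim1 : Tendsto (fun n => ‖damping n (cfc h G) x‖ ^ 2) atTop
      (𝓝 (‖(cfc h G).ker.starProjection x‖ ^ 2)) :=
    ((tendsto_damping hpos x).norm).pow 2
  have hlim2 : Tendsto (fun n => ‖damping n (cfc h G) x‖ ^ 2) atTop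
      (𝓝 (∫ s, Set.indicator {s | h s = 0} 1 s ∂ν)) := by
    simp_rw [hdamp, fun n => hν.norm_cfc_apply_sq hG (hcont n)]
    refine tendsto_integral_of_dominated_convergence (fun _ => 1)
      (fun n => (hν.integrable ((hcont n).pow 2)).aestronglyMeasurable) (integrable_const 1)
      (fun n => ?_) ?_
    · filter_upwards [hν.ae_mem] with s hs
      have := hden n s hs
      rw [Real.norm_of_nonneg (by positivity)]
      exact pow_le_one₀ (by positivity) (inv_le_one_of_one_le₀ this)
    · filter_upwards [hν.ae_mem] with s hs
      rcases (h0 s hs).eq_or_lt with hz | hz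
      · simp [← hz]
      · have hz' : s ∉ {s | h s = 0} := fun h' => hz.ne' h'
        rw [Set.indicator_of_notMem hz']
        have h2 : Tendsto (fun n : ℕ => 1 + ((n : ℝ) + 1) * h s) atTop atTop :=
          tendsto_atTop_add_const_left _ _ ((tendsto_atTop_add_const_right _ _
            tendsto_natCast_atTop_atTop).atTop_mul_const hz)
        simpa using h2.inv_tendsto_atTop.pow 2
  rw [tendsto_nhds_unique hlim1 hlim2,
    integral_indicator_one (isClosed_eq hc continuous_const).measurableSet]

end SpectralMeasure

/-! ### The spectral family of a resolvent -/

theorem tendsto_of_norm_sub_sq {H α : Type*} [NormedAddCommGroup H] {l : Filter α} {f : α → H}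
    {y : H} (h : Tendsto (fun a => ‖f a - y‖ ^ 2) l (𝓝 0)) : Tendsto f l (𝓝 y) := by
  rw [tendsto_iff_norm_sub_tendsto_zero]
  have := (Real.continuous_sqrt.tendsto 0).comp h
  rw [Real.sqrt_zero] at this
  exact this.congr fun a => Real.sqrt_sq (norm_nonneg _)

section Projections

variable {H : Type*} [NormedAddCommGroup H] [InnerProductSpace ℂ H] [CompleteSpace H]

theorem _root_.IsStarProjection.norm_sq_add {p : H →L[ℂ] H} (hp : IsStarProjection p) (x : H) :
    ‖p x‖ ^ 2 + ‖x - p x‖ ^ 2 = ‖x‖ ^ 2 := by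
  have h1 := hp.re_inner_self_apply x
  have h2 := hp.one_sub.re_inner_self_apply x
  simp only [_root_.sub_apply, one_apply_eq_self, inner_sub_right, Complex.sub_re, re_inner_self]
    at h2
  linarith

theorem norm_sub_sq_of_mul_eq {p q : H →L[ℂ] H} (hp : IsStarProjection p) (h : p * q = p) (x : H) :
    ‖q x - p x‖ ^ 2 = ‖q x‖ ^ 2 - ‖p x‖ ^ 2 := by
  have h1 : p (q x) = p x := congrArg (fun B : H →L[ℂ] H => B x) h
  have h2 := hp.norm_sq_add (q x)
  rw [h1] at h2
  linarith

end Projections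

section Family

variable {H : Type*} [NormedAddCommGroup H] [InnerProductSpace ℂ H] [CompleteSpace H]
  {G : H →L[ℂ] H}

/-- A continuous function which, for `s > 0`, vanishes exactly where `1 / s - 1 ≤ t`. -/
def cutoff (t s : ℝ) : ℝ := max (1 - (1 + t) * s) 0

theorem continuous_cutoff (t : ℝ) : Continuous (cutoff t) := by
  unfold cutoff; fun_prop

theorem cutoff_nonneg (t s : ℝ) : 0 ≤ cutoff t s := le_max_right _ _

theorem cutoff_eq_zero_iff {t s : ℝ} (hs : 0 < s) : cutoff t s = 0 ↔ s⁻¹ - 1 ≤ t := by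
  rw [cutoff, max_eq_right_iff, sub_nonpos, sub_le_iff_le_add, ← one_div, div_le_iff₀ hs, add_comm]

theorem cutoff_anti {s t u : ℝ} (hu : 0 ≤ u) (h : s ≤ t) : cutoff t u ≤ cutoff s u :=
  max_le_max_right _ (by nlinarith)

/-- The projection onto the spectral subspace of `G⁻¹ - 1` for `(-∞, t]`, where `G` is bounded,
positive and injective. -/
def cutoffProj (G : H →L[ℂ] H) (t : ℝ) : H →L[ℂ] H := (cfc (cutoff t) G).ker.starProjection

theorem isStarProjection_cutoffProj (G : H →L[ℂ] H) (t : ℝ) :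
    IsStarProjection (cutoffProj G t) := isStarProjection_starProjection

variable {x : H} {ν : Measure ℝ}

theorem IsSpectralMeasure.ae_pos (hG : 0 ≤ G) (hinj : G.ker = ⊥) (hν : IsSpectralMeasure G x ν) :
    ∀ᵐ s ∂ν, 0 < s := by
  have := hν.finite
  have hsa : IsSelfAdjoint G := .of_nonneg hG
  have h := hν.norm_starProjection_ker_sq hsa continuous_id'
    fun s hs => spectrum_nonneg_of_nonneg hG hs
  rw [cfc_id' ℝ G] at h
  have hx : G.ker.starProjection x = 0 :=
    (Submodule.eq_bot_iff _).1 hinj _ (Submodule.starProjection_apply_mem _ x)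
  have h0 : ν {s | s = 0} = 0 := by
    rw [← measureReal_eq_zero_iff, ← h, hx]; simp
  filter_upwards [hν.ae_mem, measure_eq_zero_iff_ae_notMem.1 h0] with s hs hs0
  exact (spectrum_nonneg_of_nonneg hG hs).lt_of_ne' hs0

theorem measurable_inv_sub_one : Measurable fun s : ℝ => s⁻¹ - 1 := by fun_prop

theorem norm_cutoffProj_sq (hG : 0 ≤ G) (hinj : G.ker = ⊥) (hν : IsSpectralMeasure G x ν) (t : ℝ) :
    ‖cutoffProj G t x‖ ^ 2 = (ν.map fun s : ℝ => s⁻¹ - 1).real (Set.Iic t) := by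
  rw [cutoffProj, hν.norm_starProjection_ker_sq (.of_nonneg hG) (continuous_cutoff t)
    fun s _ => cutoff_nonneg t s, map_measureReal_apply measurable_inv_sub_one measurableSet_Iic]
  refine measureReal_congr ?_
  filter_upwards [hν.ae_pos hG hinj] with s hs
  exact propext (cutoff_eq_zero_iff hs)

theorem cutoffProj_mul (hG : 0 ≤ G) {s t : ℝ} (hst : s ≤ t) :
    cutoffProj G s * cutoffProj G t = cutoffProj G s := by
  refine Submodule.starProjection_comp_starProjection_of_le fun y hy => ?_
  obtain ⟨ν, hν⟩ := exists_isSpectralMeasure (.of_nonneg hG) y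
  have hs := hν.norm_cfc_apply_sq (.of_nonneg hG) (continuous_cutoff s).continuousOn
  have ht := hν.norm_cfc_apply_sq (.of_nonneg hG) (continuous_cutoff t).continuousOn
  have hy' : cfc (cutoff s) G y = 0 := hy
  rw [hy', norm_zero, zero_pow two_ne_zero] at hs
  have hle : ∫ u, cutoff t u ^ 2 ∂ν ≤ ∫ u, cutoff s u ^ 2 ∂ν := by
    refine integral_mono_ae (hν.integrable ((continuous_cutoff t).continuousOn.pow 2))
      (hν.integrable ((continuous_cutoff s).continuousOn.pow 2)) ?_
    filter_upwards [hν.ae_mem] with u hu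
    have := cutoff_anti (spectrum_nonneg_of_nonneg hG hu) hst
    have := cutoff_nonneg t u
    gcongr
  have : ‖cfc (cutoff t) G y‖ ^ 2 ≤ 0 := by rw [ht, hs]; exact hle
  have h0 : ‖cfc (cutoff t) G y‖ = 0 := by nlinarith [norm_nonneg (cfc (cutoff t) G y)]
  exact norm_eq_zero.1 h0

/-- The spectral family of `G⁻¹ - 1`, where `G` is bounded, positive and injective. -/
def cutoffFamily (hG : 0 ≤ G) (hinj : G.ker = ⊥) : SpectralFamily H where
  proj := cutoffProj G
  isStarProjection := isStarProjection_cutoffProj G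
  proj_mul _ _ h := cutoffProj_mul hG h
  right_continuous x t := by
    obtain ⟨ν, hν⟩ := exists_isSpectralMeasure (.of_nonneg hG) x
    have := hν.finite
    set μ := ν.map fun s : ℝ => s⁻¹ - 1 with hμ
    have hfin : IsFiniteMeasure μ := by rw [hμ]; infer_instance
    refine tendsto_of_norm_sub_sq ?_
    have h1 : Tendsto (fun s => μ (Set.Iic s)) (𝓝[>] t) (𝓝 (μ (⋂ r > t, Set.Iic r))) :=
      tendsto_measure_biInter_gt (fun r _ => measurableSet_Iic.nullMeasurableSet)
        (fun i j _ h => Set.Iic_subset_Iic.2 h) ⟨t + 1, by simp, measure_ne_top _ _⟩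
    have h2 : (⋂ r > t, Set.Iic r) = Set.Iic t := by
      ext u
      simp only [gt_iff_lt, Set.mem_iInter, Set.mem_Iic]
      exact ⟨fun h => le_of_forall_gt_imp_ge_of_dense h, fun h r hr => h.trans hr.le⟩
    rw [h2] at h1
    have h3 := ((ENNReal.tendsto_toReal (measure_ne_top μ _)).comp h1).sub_const
      (μ.real (Set.Iic t))
    change Tendsto _ _ (𝓝 (μ.real (Set.Iic t) - μ.real (Set.Iic t))) at h3
    rw [sub_self] at h3
    refine h3.congr' ?_
    filter_upwards [self_mem_nhdsWithin] with s hs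
    rw [norm_sub_sq_of_mul_eq (isStarProjection_cutoffProj G t)
      (cutoffProj_mul hG (le_of_lt hs)), norm_cutoffProj_sq hG hinj hν,
      norm_cutoffProj_sq hG hinj hν]
    rfl
  tendsto_atBot x := by
    obtain ⟨ν, hν⟩ := exists_isSpectralMeasure (.of_nonneg hG) x
    have := hν.finite
    refine tendsto_const_nhds.congr' ?_
    filter_upwards [eventually_lt_atBot (-1)] with t ht
    have h := norm_cutoffProj_sq hG hinj hν t
    have h0 : (ν.map fun s : ℝ => s⁻¹ - 1) (Set.Iic t) = 0 := by
      rw [Measure.map_apply measurable_inv_sub_one measurableSet_Iic,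
        measure_eq_zero_iff_ae_notMem]
      filter_upwards [hν.ae_pos hG hinj] with s hs hs'
      have h1 : s⁻¹ - 1 ≤ t := hs'
      have h2 : 0 < s⁻¹ := inv_pos.2 hs
      linarith
    rw [measureReal_def, h0, ENNReal.toReal_zero] at h
    exact (norm_eq_zero.1 (pow_eq_zero_iff two_ne_zero |>.1 h)).symm
  tendsto_atTop x := by
    obtain ⟨ν, hν⟩ := exists_isSpectralMeasure (.of_nonneg hG) x
    have := hν.finite
    set μ := ν.map fun s : ℝ => s⁻¹ - 1 with hμ
    have hfin : IsFiniteMeasure μ := by rw [hμ]; infer_instance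
    refine tendsto_of_norm_sub_sq ?_
    have huniv : μ.real Set.univ = ‖x‖ ^ 2 := by
      rw [hμ, map_measureReal_apply measurable_inv_sub_one .univ, Set.preimage_univ,
        hν.real_univ (.of_nonneg hG)]
    have h3 := ((ENNReal.tendsto_toReal (measure_ne_top μ _)).comp
      (tendsto_measure_Iic_atTop μ)).const_sub (‖x‖ ^ 2)
    change Tendsto _ _ (𝓝 (‖x‖ ^ 2 - μ.real Set.univ)) at h3
    rw [huniv, sub_self] at h3
    refine h3.congr fun t => ?_
    have h4 := (isStarProjection_cutoffProj G t).norm_sq_add x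
    have h5 := norm_cutoffProj_sq hG hinj hν t
    rw [norm_sub_rev, eq_sub_of_add_eq' h4, h5]
    rfl

theorem SpectralFamily.stieltjes_tendsto_atBot (E : SpectralFamily H) (x : H) :
    Tendsto (E.stieltjes x) atBot (𝓝 0) := by
  have h := (E.tendsto_atBot x).norm.pow 2
  rw [norm_zero, zero_pow two_ne_zero] at h
  exact h

theorem SpectralFamily.stieltjes_tendsto_atTop (E : SpectralFamily H) (x : H) :
    Tendsto (E.stieltjes x) atTop (𝓝 (‖x‖ ^ 2)) :=
  (E.tendsto_atTop x).norm.pow 2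

theorem SpectralFamily.measure_Iic (E : SpectralFamily H) (x : H) (t : ℝ) :
    E.measure x (Set.Iic t) = ENNReal.ofReal (‖E.proj t x‖ ^ 2) := by
  rw [SpectralFamily.measure, StieltjesFunction.measure_Iic _ (E.stieltjes_tendsto_atBot x),
    sub_zero]
  rfl

instance SpectralFamily.isFiniteMeasure_measure (E : SpectralFamily H) (x : H) :
    IsFiniteMeasure (E.measure x) :=
  StieltjesFunction.isFiniteMeasure _ (E.stieltjes_tendsto_atBot x) (E.stieltjes_tendsto_atTop x)

theorem cutoffFamily_measure (hG : 0 ≤ G) (hinj : G.ker = ⊥) (hν : IsSpectralMeasure G x ν) :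
    (cutoffFamily hG hinj).measure x = ν.map fun s : ℝ => s⁻¹ - 1 := by
  have := hν.finite
  refine Measure.ext_of_Iic _ _ fun t => ?_
  rw [SpectralFamily.measure_Iic, ← ofReal_measureReal, ← norm_cutoffProj_sq hG hinj hν]
  rfl

end Family

/-! ### The spectral theorem for positive self-adjoint operators -/

section Unbounded

/-- A positive self-adjoint operator, encoded as a symmetric positive operator `S` for which
`1 + S` is surjective. -/
structure IsPositiveSelfAdjoint {H : Type*} [NormedAddCommGroup H] [InnerProductSpace ℂ H]
    (S : H →ₗ.[ℂ] H) : Prop where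
  symm : ∀ x y : S.domain, ⟪S x, (y : H)⟫_ℂ = ⟪(x : H), S y⟫_ℂ
  nonneg : ∀ x : S.domain, 0 ≤ (⟪(x : H), S x⟫_ℂ).re
  surj : ∀ y : H, ∃ x : S.domain, (x : H) + S x = y

theorem IsPositiveSelfAdjoint.norm_le {H : Type*} [NormedAddCommGroup H]
    [InnerProductSpace ℂ H] {S : H →ₗ.[ℂ] H} (hS : IsPositiveSelfAdjoint S) 
    (x : S.domain) : ‖(x : H)‖ ≤ ‖(x : H) + S x‖ := by
  have h1 : ‖(x : H)‖ ^ 2 ≤ (⟪(x : H), (x : H) + S x⟫_ℂ).re := by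
    rw [inner_add_right, Complex.add_re, re_inner_self]
    linarith [hS.nonneg x]
  have h2 : (⟪(x : H), (x : H) + S x⟫_ℂ).re ≤ ‖(x : H)‖ * ‖(x : H) + S x‖ :=
    re_inner_le_norm (𝕜 := ℂ) _ _
  rcases (norm_nonneg (x : H)).eq_or_lt with h0 | h0
  · rw [← h0]; positivity
  · nlinarith

variable {H : Type*} [NormedAddCommGroup H] [InnerProductSpace ℂ H] {S : H →ₗ.[ℂ] H}

/-- The resolvent `G = (1 + S)⁻¹`. -/
theorem IsPositiveSelfAdjoint.exists_resolvent (hS : IsPositiveSelfAdjoint S) :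
    ∃ G : H →L[ℂ] H, 0 ≤ G ∧ G.ker = ⊥ ∧ (∀ x : S.domain, G ((x : H) + S x) = x) ∧
      ∀ y, ∃ h : G y ∈ S.domain, G y + S ⟨G y, h⟩ = y := by
  set F : S.domain →ₗ[ℂ] H := S.domain.subtype + S.toFun with hF
  have hFx : ∀ x : S.domain, F x = (x : H) + S x := fun x => rfl
  have hbij : Function.Bijective F := by
    refine ⟨(injective_iff_map_eq_zero F).2 fun x hx => ?_, fun y => hS.surj y⟩
    have := hS.norm_le x
    rw [← hFx, hx, norm_zero, norm_le_zero_iff] at this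
    exact Subtype.ext this
  set e := LinearEquiv.ofBijective F hbij with he
  have hFe : ∀ y, F (e.symm y) = y := fun y => e.apply_symm_apply y
  set G : H →L[ℂ] H := (S.domain.subtype ∘ₗ e.symm.toLinearMap).mkContinuous 1 fun y => by
    have := hS.norm_le (e.symm y)
    rw [← hFx, hFe] at this
    simpa using this with hG
  have hGy : ∀ y, G y = (e.symm y : S.domain) := fun y => rfl
  refine ⟨G, ?_, ?_, fun x => ?_, fun y => ⟨(e.symm y).2, hFe y⟩⟩
  · rw [ContinuousLinearMap.nonneg_iff_isPositive]
    refine ⟨fun y z => ?_, fun y => ?_⟩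
    · change ⟪G y, z⟫_ℂ = ⟪y, G z⟫_ℂ
      have h1 : ⟪(e.symm y : H), F (e.symm z)⟫_ℂ = ⟪F (e.symm y), (e.symm z : H)⟫_ℂ := by
        rw [hFx, hFx, inner_add_left, inner_add_right, hS.symm]
      rwa [hFe, hFe] at h1
    · rw [ContinuousLinearMap.reApplyInnerSelf]
      change 0 ≤ (⟪G y, y⟫_ℂ).re
      have h1 : 0 ≤ (⟪(e.symm y : H), F (e.symm y)⟫_ℂ).re := by
        rw [hFx, inner_add_right, Complex.add_re, re_inner_self]
        have := hS.nonneg (e.symm y)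
        positivity
      rwa [hFe] at h1
  · refine (Submodule.eq_bot_iff _).2 fun y hy => ?_
    have h1 : e.symm y = 0 := Subtype.ext hy
    simpa using h1
  · rw [← hFx, hGy]
    exact congrArg Subtype.val (e.symm_apply_apply x)

variable [CompleteSpace H] {G : H →L[ℂ] H} {x : H} {ν : Measure ℝ}

theorem IsSpectralMeasure.apply_self (hG : IsSelfAdjoint G) (hν : IsSpectralMeasure G x ν) :
    IsSpectralMeasure G (G x) (ν.withDensity fun s => ENNReal.ofReal (s ^ 2)) := by
  have hm : Measurable fun s : ℝ => ENNReal.ofReal (s ^ 2) := by fun_prop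
  refine ⟨?_, (withDensity_absolutelyContinuous ν _).ae_le hν.ae_mem, fun f hf => ?_⟩
  · refine isFiniteMeasure_withDensity_ofReal ?_
    exact (hν.integrable (continuousOn_id.pow 2)).2
  · rw [integral_withDensity_eq_integral_toReal_smul hm (ae_of_all _ fun s => ENNReal.ofReal_lt_top)]
    have h1 : ∀ s : ℝ, (ENNReal.ofReal (s ^ 2)).toReal • f s = s * (f s * s) := fun s => by
      rw [ENNReal.toReal_ofReal (by positivity), smul_eq_mul]; ring
    simp_rw [h1]
    rw [hν.integral_eq (fun s => s * (f s * s)) (continuousOn_id.mul (hf.mul continuousOn_id)),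
      cfc_mul (fun s : ℝ => s) (fun s => f s * s) G continuousOn_id (hf.mul continuousOn_id),
      cfc_mul f (fun s : ℝ => s) G hf continuousOn_id, cfc_id' ℝ G, mul_apply_eq_comp,
      mul_apply_eq_comp, ← ContinuousLinearMap.adjoint_inner_left, hG.adjoint_eq]

/-- Only vectors `x` with `∫ s⁻² d⟨E s x, x⟩ < ∞` lie in the range of `G`, and these do: the
vectors `g n (G) x` with `g n s = (1 / (n + 1) + s)⁻¹` form a Cauchy sequence. -/
theorem IsSpectralMeasure.exists_apply_eq (hG : 0 ≤ G) (hinj : G.ker = ⊥)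
    (hν : IsSpectralMeasure G x ν) (hint : Integrable (fun s => (s⁻¹) ^ 2) ν) : ∃ y, G y = x := by
  have hfin := hν.finite
  have hsa : IsSelfAdjoint G := .of_nonneg hG
  set g : ℕ → ℝ → ℝ := fun n s => ((n : ℝ) + 1) * (1 + ((n : ℝ) + 1) * s)⁻¹ with hg
  have hgc : ∀ n, ContinuousOn (g n) (spectrum ℝ G) := fun n =>
    continuousOn_const.mul (continuousOn_damping hG n)
  set y : ℕ → H := fun n => cfc (g n) G x with hy
  have hgy : ∀ n, cfc (g n) G = ((n : ℝ) + 1) • damping n G := fun n => by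
    rw [damping, ← cfc_smul _ _ G (continuousOn_damping hG n)]
    rfl
  have hgle : ∀ n s, 0 < s → g n s ≤ s⁻¹ := fun n s hs => by
    simp only [hg]
    rw [← div_eq_mul_inv, ← one_div, div_le_div_iff₀ (by positivity) hs]
    linarith
  have hgmono : ∀ n m s, n ≤ m → 0 < s → g n s ≤ g m s := fun n m s hnm hs => by
    have : (n : ℝ) ≤ m := by exact_mod_cast hnm
    simp only [hg]
    rw [← div_eq_mul_inv, ← div_eq_mul_inv, div_le_div_iff₀ (by positivity) (by positivity)]
    nlinarith
  have hg0 : ∀ n s, 0 < s → 0 ≤ g n s := fun n s hs => by positivity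
  have hGy : Tendsto (fun n => G (y n)) atTop (𝓝 x) := by
    have h1 : ∀ n, G (y n) = x - damping n G x := fun n => by
      have h2 : G * cfc (g n) G = 1 - damping n G := by
        rw [hgy, mul_smul_comm, eq_sub_iff_add_eq', ← damping_add_smul hG n]
        congr 2
        exact ((Commute.refl G).cfc_real _).eq.symm
      exact congrArg (fun B : H →L[ℂ] H => B x) h2
    have hx : G.ker.starProjection x = 0 :=
      (Submodule.eq_bot_iff _).1 hinj _ (Submodule.starProjection_apply_mem _ x)
    have h3 := (tendsto_damping hG x).const_sub x
    rw [hx, sub_zero] at h3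
    exact h3.congr fun n => (h1 n).symm
  have hpos := hν.ae_pos hG hinj
  have hmeas : ∀ n, AEStronglyMeasurable (fun s => (s⁻¹ - g n s) ^ 2) ν := fun n => by
    have : Measurable (g n) := by simp only [hg]; fun_prop
    exact Measurable.aestronglyMeasurable (by fun_prop)
  have hbound : ∀ n, ∀ᵐ s ∂ν, ‖(s⁻¹ - g n s) ^ 2‖ ≤ (s⁻¹) ^ 2 := fun n => by
    filter_upwards [hpos] with s hs
    rw [Real.norm_of_nonneg (by positivity)]
    have h1 := hgle n s hs
    have h2 := hg0 n s hs
    exact pow_le_pow_left₀ (by linarith) (by linarith) 2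
  have hb : Tendsto (fun n => √(∫ s, (s⁻¹ - g n s) ^ 2 ∂ν)) atTop (𝓝 0) := by
    have h1 : Tendsto (fun n => ∫ s, (s⁻¹ - g n s) ^ 2 ∂ν) atTop (𝓝 (∫ _, (0 : ℝ) ∂ν)) := by
      refine tendsto_integral_of_dominated_convergence _ hmeas hint hbound ?_
      filter_upwards [hpos] with s hs
      have h2 : Tendsto (fun n : ℕ => 1 + ((n : ℝ) + 1) * s) atTop atTop :=
        tendsto_atTop_add_const_left _ _ ((tendsto_atTop_add_const_right _ _
          tendsto_natCast_atTop_atTop).atTop_mul_const hs)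
      have h3 : ∀ n : ℕ, (s⁻¹ * (1 + ((n : ℝ) + 1) * s)⁻¹) ^ 2 = (s⁻¹ - g n s) ^ 2 := fun n => by
        have : 1 + ((n : ℝ) + 1) * s ≠ 0 := by positivity
        congr 1
        simp only [hg]
        field_simp
        ring
      have h4 := (h2.inv_tendsto_atTop.const_mul s⁻¹).pow 2
      rw [mul_zero, zero_pow two_ne_zero] at h4
      exact h4.congr h3
    rw [integral_zero] at h1
    have h2 := (Real.continuous_sqrt.tendsto 0).comp h1
    rw [Real.sqrt_zero] at h2
    exact h2
  have hcauchy : CauchySeq y := by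
    refine cauchySeq_of_le_tendsto_0 _ (fun n m N hn hm => ?_) hb
    rw [dist_eq_norm]
    refine Real.le_sqrt_of_sq_le ?_
    have h1 : y n - y m = cfc (fun s => g n s - g m s) G x := by
      rw [cfc_sub (g n) (g m) G (hgc n) (hgc m)]
      rfl
    rw [h1, hν.norm_cfc_apply_sq hsa (f := fun s => g n s - g m s) ((hgc n).sub (hgc m))]
    refine integral_mono_ae (hν.integrable (((hgc n).sub (hgc m)).pow 2))
      (hint.mono' (hmeas N) (hbound N)) ?_
    filter_upwards [hpos] with s hs
    have h2 := hgle n s hs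
    have h3 := hgle m s hs
    have h4 := hgmono N n s hn hs
    have h5 := hgmono N m s hm hs
    exact sq_le_sq' (by linarith) (by linarith)
  obtain ⟨z, hz⟩ := cauchySeq_tendsto_of_complete hcauchy
  exact ⟨z, tendsto_nhds_unique ((G.continuous.tendsto z).comp hz) hGy⟩

/-- The spectral theorem for positive self-adjoint operators. -/
theorem IsPositiveSelfAdjoint.exists_resolution (hS : IsPositiveSelfAdjoint S) :
    ∃ E : SpectralFamily H, E.IsResolutionOf S := by
  obtain ⟨G, hG, hinj, hleft, hright⟩ := hS.exists_resolvent
  have hsa : IsSelfAdjoint G := .of_nonneg hG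
  have hsq : Measurable fun t : ℝ => ENNReal.ofReal (t ^ 2) := by fun_prop
  have hlint : ∀ x ν, IsSpectralMeasure G x ν →
      ∫⁻ t, ENNReal.ofReal (t ^ 2) ∂((cutoffFamily hG hinj).measure x) =
        ∫⁻ s, ENNReal.ofReal ((s⁻¹ - 1) ^ 2) ∂ν := fun x ν hν => by
    rw [cutoffFamily_measure hG hinj hν, lintegral_map hsq measurable_inv_sub_one]
  refine ⟨cutoffFamily hG hinj, fun x => ⟨fun hx => ?_, fun hx => ?_⟩, fun x => ?_⟩
  · set y := x + S ⟨x, hx⟩ with hy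
    have hGy : G y = x := hleft ⟨x, hx⟩
    obtain ⟨ν, hν⟩ := exists_isSpectralMeasure hsa y
    have hν' := hν.apply_self hsa
    rw [hGy] at hν'
    rw [hlint x _ hν', lintegral_withDensity_eq_lintegral_mul _ hsq (by fun_prop)]
    have hi := (hν.integrable (f := fun s => (1 - s) ^ 2) (by fun_prop)).2
    rw [HasFiniteIntegral] at hi
    refine lt_of_le_of_lt (lintegral_mono_ae ?_) hi
    filter_upwards [hν.ae_pos hG hinj] with s hs
    rw [Pi.mul_apply, ← ENNReal.ofReal_mul (by positivity), Real.enorm_eq_ofReal (by positivity)]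
    refine ENNReal.ofReal_le_ofReal (le_of_eq ?_)
    field_simp
  · obtain ⟨ν, hν⟩ := exists_isSpectralMeasure hsa x
    have hfin := hν.finite
    rw [hlint x ν hν] at hx
    have hi : Integrable (fun s : ℝ => (s⁻¹ - 1) ^ 2) ν := by
      refine ⟨Measurable.aestronglyMeasurable (by fun_prop), ?_⟩
      rw [HasFiniteIntegral]
      simp_rw [Real.enorm_eq_ofReal (sq_nonneg _)]
      exact hx
    have hint : Integrable (fun s : ℝ => (s⁻¹) ^ 2) ν := by
      refine ((hi.const_mul 2).add (integrable_const 2)).mono'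
        (Measurable.aestronglyMeasurable (by fun_prop)) (ae_of_all _ fun s => ?_)
      rw [Real.norm_of_nonneg (by positivity)]
      simp only [Pi.add_apply]
      nlinarith [sq_nonneg (s⁻¹ - 2)]
    obtain ⟨y, rfl⟩ := hν.exists_apply_eq hG hinj hint
    exact (hright y).1
  · set y := (x : H) + S x with hy
    have hGy : G y = x := hleft x
    obtain ⟨ν, hν⟩ := exists_isSpectralMeasure hsa y
    have hν' := hν.apply_self hsa
    rw [hGy] at hν'
    have himag : (⟪(x : H), S x⟫_ℂ).im = 0 := by
      have h := hS.symm x x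
      rw [← inner_conj_symm] at h
      have := congrArg Complex.im h
      rw [Complex.conj_im] at this
      linarith
    refine Complex.ext ?_ (by rw [himag, Complex.ofReal_im])
    have hSx : S x = y - G y := by rw [hGy, hy]; abel
    rw [Complex.ofReal_re, cutoffFamily_measure hG hinj hν',
      integral_map measurable_inv_sub_one.aemeasurable measurable_id'.aestronglyMeasurable,
      integral_withDensity_eq_integral_toReal_smul hsq (ae_of_all _ fun s => ENNReal.ofReal_lt_top)]
    have h1 : ∫ s, (ENNReal.ofReal (s ^ 2)).toReal • (s⁻¹ - 1) ∂ν = ∫ s, s * (1 - s) ∂ν := by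
      refine integral_congr_ae ?_
      filter_upwards [hν.ae_pos hG hinj] with s hs
      rw [ENNReal.toReal_ofReal (by positivity), smul_eq_mul]
      field_simp
    rw [h1, hν.integral_eq _ (by fun_prop), cfc_mul (fun s : ℝ => s) (fun s => 1 - s) G,
      cfc_sub (fun _ : ℝ => (1 : ℝ)) (fun s => s) G, cfc_const_one ℝ G, cfc_id' ℝ G,
      mul_apply_eq_comp, ← ContinuousLinearMap.adjoint_inner_left, hsa.adjoint_eq, hSx,
      _root_.sub_apply, one_apply_eq_self, hGy]

end Unbounded

/-! ### Spectral subspaces of an arbitrary resolution -/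

section Resolution

variable {H : Type*} [NormedAddCommGroup H] [InnerProductSpace ℂ H] [CompleteSpace H]

namespace SpectralFamily

variable (E : SpectralFamily H)

theorem proj_proj_of_le {s t : ℝ} (h : s ≤ t) (x : H) : E.proj s (E.proj t x) = E.proj s x :=
  congrArg (fun B : H →L[ℂ] H => B x) (E.proj_mul s t h)

theorem proj_proj_of_ge {s t : ℝ} (h : t ≤ s) (x : H) : E.proj s (E.proj t x) = E.proj t x := by
  have h1 := congrArg star (E.proj_mul t s h)
  rw [star_mul, (E.isStarProjection t).isSelfAdjoint.star_eq,
    (E.isStarProjection s).isSelfAdjoint.star_eq] at h1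
  exact congrArg (fun B : H →L[ℂ] H => B x) h1

theorem inner_proj_left (t : ℝ) (x y : H) : ⟪E.proj t x, y⟫_ℂ = ⟪x, E.proj t y⟫_ℂ := by
  rw [← ContinuousLinearMap.adjoint_inner_right, (E.isStarProjection t).isSelfAdjoint.adjoint_eq]

theorem measure_univ (x : H) : E.measure x Set.univ = ENNReal.ofReal (‖x‖ ^ 2) := by
  rw [SpectralFamily.measure, StieltjesFunction.measure_univ _ (E.stieltjes_tendsto_atBot x)
    (E.stieltjes_tendsto_atTop x), sub_zero]

theorem measureReal_univ (x : H) : (E.measure x).real Set.univ = ‖x‖ ^ 2 := by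
  rw [measureReal_def, measure_univ, ENNReal.toReal_ofReal (by positivity)]

theorem ae_le {t : ℝ} {x : H} (h : E.proj t x = x) : ∀ᵐ s ∂E.measure x, s ≤ t := by
  have h1 : E.measure x (Set.Iic t) = E.measure x Set.univ := by
    rw [measure_Iic, h, measure_univ]
  have h2 : E.measure x (Set.Iic t)ᶜ = 0 := by
    rw [measure_compl measurableSet_Iic (measure_ne_top _ _), h1, tsub_self]
  filter_upwards [measure_eq_zero_iff_ae_notMem.1 h2] with s hs
  exact not_not.1 hs

theorem ae_gt {t : ℝ} {x : H} (h : E.proj t x = 0) : ∀ᵐ s ∂E.measure x, t < s := by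
  have h1 : E.measure x (Set.Iic t) = 0 := by
    rw [measure_Iic, h]; simp
  filter_upwards [measure_eq_zero_iff_ae_notMem.1 h1] with s hs
  exact not_le.1 hs

theorem measure_add {t : ℝ} {u v : H} (hu : E.proj t u = u) (hv : E.proj t v = 0) :
    E.measure (u + v) = E.measure u + E.measure v := by
  refine Measure.ext_of_Iic _ _ fun s => ?_
  rw [Measure.add_apply, measure_Iic, measure_Iic, measure_Iic,
    ← ENNReal.ofReal_add (by positivity) (by positivity), map_add]
  congr 1
  have h0 : ⟪E.proj s u, E.proj s v⟫_ℂ = 0 := by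
    rcases le_total s t with hst | hst
    · have : E.proj s v = 0 := by rw [← E.proj_proj_of_le hst, hv, map_zero]
      rw [this, inner_zero_right]
    · have h1 : E.proj s u = u := by rw [← hu, E.proj_proj_of_ge hst]
      rw [h1, ← hu, inner_proj_left, E.proj_proj_of_le hst, hv, inner_zero_right]
  have := norm_add_sq_eq_norm_sq_add_norm_sq_of_inner_eq_zero (𝕜 := ℂ) _ _ h0
  simpa only [sq] using this

end SpectralFamily

namespace SpectralFamily.IsResolutionOf

variable {E : SpectralFamily H} {S : H →ₗ.[ℂ] H}

theorem integrable (hE : E.IsResolutionOf S) {x : H} (hx : x ∈ S.domain) :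
    Integrable (fun t : ℝ => t) (E.measure x) := by
  have h := (hE.1 x).1 hx
  have h2 : Integrable (fun t : ℝ => t ^ 2) (E.measure x) := by
    refine ⟨Measurable.aestronglyMeasurable (by fun_prop), ?_⟩
    rw [HasFiniteIntegral]
    simp_rw [Real.enorm_eq_ofReal (sq_nonneg _)]
    exact h
  refine (h2.add (integrable_const 1)).mono' (Measurable.aestronglyMeasurable (by fun_prop))
    (ae_of_all _ fun t => ?_)
  simp only [Pi.add_apply]
  rw [Real.norm_eq_abs, ← sq_abs]
  nlinarith [sq_nonneg (|t| - 1)]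

theorem mem_domain (hE : E.IsResolutionOf S) {a b : ℝ} {x : H} (ha : E.proj a x = 0)
    (hb : E.proj b x = x) : x ∈ S.domain := by
  rw [hE.1]
  refine lt_of_le_of_lt (lintegral_mono_ae (g := fun _ => ENNReal.ofReal (a ^ 2 + b ^ 2)) ?_) ?_
  · filter_upwards [E.ae_gt ha, E.ae_le hb] with t h1 h2
    refine ENNReal.ofReal_le_ofReal ?_
    rcases le_total 0 t with h0 | h0 <;> nlinarith [sq_nonneg a, sq_nonneg b]
  · rw [lintegral_const]
    exact ENNReal.mul_lt_top ENNReal.ofReal_lt_top (measure_lt_top _ _)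

theorem inner_re (hE : E.IsResolutionOf S) (x : S.domain) :
    (⟪(x : H), S x⟫_ℂ).re = ∫ t, t ∂(E.measure (x : H)) := by
  rw [hE.2, Complex.ofReal_re]

theorem inner_re_le (hE : E.IsResolutionOf S) {b : ℝ} (x : S.domain) (hb : E.proj b x = x) :
    (⟪(x : H), S x⟫_ℂ).re ≤ b * ‖(x : H)‖ ^ 2 := by
  rw [hE.inner_re, ← E.measureReal_univ, mul_comm, ← smul_eq_mul, ← integral_const]
  exact integral_mono_ae (hE.integrable x.2) (integrable_const b) (E.ae_le hb)

theorem le_inner_re (hE : E.IsResolutionOf S) {a : ℝ} (x : S.domain) (ha : E.proj a x = 0) :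
    a * ‖(x : H)‖ ^ 2 ≤ (⟪(x : H), S x⟫_ℂ).re := by
  rw [hE.inner_re, ← E.measureReal_univ, mul_comm, ← smul_eq_mul, ← integral_const]
  refine integral_mono_ae (integrable_const a) (hE.integrable x.2) ?_
  filter_upwards [E.ae_gt ha] with t ht using ht.le

theorem le_norm_apply (hE : E.IsResolutionOf S) {a : ℝ} (x : S.domain) (ha : E.proj a x = 0) :
    a * ‖(x : H)‖ ≤ ‖S x‖ := by
  have h1 := hE.le_inner_re x ha
  have h2 : (⟪(x : H), S x⟫_ℂ).re ≤ ‖(x : H)‖ * ‖S x‖ := re_inner_le_norm (𝕜 := ℂ) _ _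
  rcases (norm_nonneg (x : H)).eq_or_lt with h0 | h0
  · rw [← h0, mul_zero]; positivity
  · exact le_of_mul_le_mul_left (by linarith) h0

theorem sub_proj (t : ℝ) (x : H) : E.proj t (x - E.proj t x) = 0 := by
  rw [map_sub, E.proj_proj_of_le le_rfl, sub_self]

theorem proj_mem_domain (hE : E.IsResolutionOf S) (t : ℝ) {x : H} (hx : x ∈ S.domain) :
    E.proj t x ∈ S.domain := by
  rw [hE.1] at hx ⊢
  have h := E.measure_add (t := t) (E.proj_proj_of_le le_rfl x) (sub_proj t x)
  rw [add_sub_cancel] at h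
  rw [h, lintegral_add_measure] at hx
  exact (le_add_of_nonneg_right zero_le).trans_lt hx

/-- The quadratic form of `S` splits along `E t` because the spectral measures do; by
polarization, so does the sesquilinear form. -/
theorem inner_apply_eq_zero (hE : E.IsResolutionOf S) (hS : IsPositiveSelfAdjoint S) {t : ℝ}
    (u v : S.domain) (hu : E.proj t u = u) (hv : E.proj t v = 0) : ⟪(u : H), S v⟫_ℂ = 0 := by
  have key : ∀ w : S.domain, E.proj t w = 0 → (⟪(u : H), S w⟫_ℂ).re = 0 := by
    intro w hw
    have h1 := hE.inner_re (u + w)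
    rw [Submodule.coe_add, E.measure_add hu hw, integral_add_measure (hE.integrable u.2)
      (hE.integrable w.2), ← hE.inner_re, ← hE.inner_re, S.map_add, inner_add_left,
      inner_add_right, inner_add_right, ← hS.symm w u, ← inner_conj_symm (S w)] at h1
    simp only [Complex.add_re, Complex.conj_re] at h1
    linarith
  have h1 := key v hv
  have h2 := key (Complex.I • v) (by rw [Submodule.coe_smul, map_smul, hv, smul_zero])
  rw [S.map_smul, inner_smul_right, Complex.I_mul_re] at h2
  exact Complex.ext h1 (by rw [Complex.zero_im]; linarith)

theorem apply_proj (hE : E.IsResolutionOf S) (hS : IsPositiveSelfAdjoint S) (t : ℝ)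
    (x : S.domain) : S ⟨E.proj t x, hE.proj_mem_domain t x.2⟩ = E.proj t (S x) := by
  have hzero : ∀ y : H, (∀ w : S.domain, ⟪(w : H), y⟫_ℂ = 0) → y = 0 := by
    intro y hy
    obtain ⟨w, hw⟩ := hS.surj y
    have h1 := congrArg Complex.re (hy w)
    rw [← hw, inner_add_right, Complex.add_re, re_inner_self, Complex.zero_re] at h1
    have h2 := hS.nonneg w
    have h3 : (w : H) = 0 := norm_eq_zero.1 (by nlinarith [norm_nonneg (w : H)])
    have h4 : w = 0 := Subtype.ext h3
    rw [← hw, h4, S.map_zero, Submodule.coe_zero, add_zero]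
  set u : S.domain := ⟨E.proj t x, hE.proj_mem_domain t x.2⟩ with hu
  have huE : E.proj t u = u := E.proj_proj_of_le le_rfl _
  have hvE : E.proj t ((x - u : S.domain) : H) = 0 := sub_proj t _
  have h1 : E.proj t (S (x - u)) = 0 := hzero _ fun w => by
    rw [← E.inner_proj_left]
    exact hE.inner_apply_eq_zero hS ⟨_, hE.proj_mem_domain t w.2⟩ _
      (E.proj_proj_of_le le_rfl _) hvE
  have h2 : S u - E.proj t (S u) = 0 := hzero _ fun w => by
    have hw := hE.inner_apply_eq_zero hS u (w - ⟨_, hE.proj_mem_domain t w.2⟩) huE (sub_proj t _)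
    rw [inner_sub_right, ← E.inner_proj_left, ← inner_sub_left, ← inner_conj_symm]
    have h3 : ⟪S u, (w : H) - E.proj t w⟫_ℂ = 0 := by rw [← hw, ← hS.symm]; rfl
    rw [h3, map_zero]
  rw [S.map_sub, map_sub, sub_eq_zero] at h1
  rw [h1, ← sub_eq_zero, h2]

theorem proj_eq_zero (hE : E.IsResolutionOf S) (hS : IsPositiveSelfAdjoint S) {t : ℝ}
    (ht : t < 0) (x : H) : E.proj t x = 0 := by
  have h : ∀ s ≤ t, E.proj s x = E.proj t x := by
    intro s hs
    have hb : E.proj t (E.proj t x - E.proj s x) = E.proj t x - E.proj s x := by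
      rw [map_sub, E.proj_proj_of_le le_rfl, E.proj_proj_of_ge hs]
    have ha : E.proj s (E.proj t x - E.proj s x) = 0 := by
      rw [map_sub, E.proj_proj_of_le le_rfl, E.proj_proj_of_le hs, sub_self]
    have hmem := hE.mem_domain ha hb
    have h1 := hE.inner_re_le ⟨_, hmem⟩ hb
    have h2 := hS.nonneg ⟨_, hmem⟩
    have h3 : ‖E.proj t x - E.proj s x‖ ^ 2 = 0 := by
      have := sq_nonneg ‖E.proj t x - E.proj s x‖
      have h4 : 0 ≤ t * ‖E.proj t x - E.proj s x‖ ^ 2 := h2.trans h1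
      nlinarith
    exact (sub_eq_zero.1 (norm_eq_zero.1 ((pow_eq_zero_iff two_ne_zero).1 h3))).symm
  refine tendsto_nhds_unique (tendsto_const_nhds.congr' ?_) (E.tendsto_atBot x)
  filter_upwards [eventually_le_atBot t] with s hs using (h s hs).symm

theorem mem_domain_of_proj_eq (hE : E.IsResolutionOf S) (hS : IsPositiveSelfAdjoint S) {t : ℝ}
    {x : H} (hx : E.proj t x = x) : x ∈ S.domain :=
  hE.mem_domain (hE.proj_eq_zero hS neg_one_lt_zero x) hx

theorem proj_apply_of_proj_eq (hE : E.IsResolutionOf S) (hS : IsPositiveSelfAdjoint S) {t : ℝ}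
    (x : S.domain) (hx : E.proj t x = x) : E.proj t (S x) = S x := by
  rw [← hE.apply_proj hS t x]
  congr 1
  exact Subtype.ext hx

/-- On the range of `E t` the form of `S` is at most `t`; positivity of the form at `x - t⁻¹ S x`
turns this into a bound for the norm. -/
theorem norm_apply_le (hE : E.IsResolutionOf S) (hS : IsPositiveSelfAdjoint S) {t : ℝ}
    (ht : 0 < t) (x : S.domain) (hx : E.proj t x = x) : ‖S x‖ ≤ t * ‖(x : H)‖ := by
  have hw := hE.proj_apply_of_proj_eq hS x hx
  set w : S.domain := ⟨S x, hE.mem_domain_of_proj_eq hS hw⟩ with hwdef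
  have h1 := hE.inner_re_le w hw
  have h2 := hS.nonneg (x - (t⁻¹ : ℂ) • w)
  have h3 : (⟪((x - (t⁻¹ : ℂ) • w : S.domain) : H), S (x - (t⁻¹ : ℂ) • w)⟫_ℂ).re =
      (⟪(x : H), S x⟫_ℂ).re - 2 * t⁻¹ * ‖S x‖ ^ 2 + t⁻¹ ^ 2 * (⟪(w : H), S w⟫_ℂ).re := by
    have h4 : ⟪(x : H), S w⟫_ℂ = ⟪S x, S x⟫_ℂ := (hS.symm x w).symm
    have h5 : ⟪(w : H), S x⟫_ℂ = ⟪S x, S x⟫_ℂ := rfl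
    rw [S.map_sub, S.map_smul, Submodule.coe_sub, Submodule.coe_smul, inner_sub_left,
      inner_sub_right, inner_sub_right, inner_smul_left, inner_smul_left, inner_smul_right,
      inner_smul_right, h4, h5, ← re_inner_self (S x), ← Complex.ofReal_inv, Complex.conj_ofReal]
    simp only [Complex.sub_re, Complex.re_ofReal_mul]
    ring
  rw [h3] at h2
  have h6 : (⟪(x : H), S x⟫_ℂ).re ≤ ‖(x : H)‖ * ‖S x‖ := re_inner_le_norm (𝕜 := ℂ) _ _
  have h7 : t⁻¹ ^ 2 * (⟪(w : H), S w⟫_ℂ).re ≤ t⁻¹ * ‖S x‖ ^ 2 := by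
    calc t⁻¹ ^ 2 * (⟪(w : H), S w⟫_ℂ).re ≤ t⁻¹ ^ 2 * (t * ‖S x‖ ^ 2) := by gcongr
      _ = t⁻¹ * ‖S x‖ ^ 2 := by field_simp
  have h8 : t⁻¹ * ‖S x‖ ^ 2 ≤ ‖(x : H)‖ * ‖S x‖ := by linarith
  rw [inv_mul_le_iff₀ ht] at h8
  rcases (norm_nonneg (S x)).eq_or_lt with h0 | h0
  · rw [← h0]; positivity
  · exact le_of_mul_le_mul_right (by linarith) h0

theorem proj_eq_of_apply_eq_zero (hE : E.IsResolutionOf S) (hS : IsPositiveSelfAdjoint S) {t : ℝ}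
    (ht : 0 < t) (x : S.domain) (hx : S x = 0) : E.proj t x = x := by
  have h1 := hE.le_norm_apply (x - ⟨_, hE.proj_mem_domain t x.2⟩) (sub_proj t (x : H))
  rw [S.map_sub, hE.apply_proj hS, hx, map_zero, sub_zero, norm_zero] at h1
  have h2 : ‖(x : H) - E.proj t x‖ ≤ 0 := by
    have : t * ‖(x : H) - E.proj t x‖ ≤ 0 := h1
    exact nonpos_of_mul_nonpos_right this ht
  exact (sub_eq_zero.1 (norm_le_zero_iff.1 h2)).symm

/-- Away from the spectral subspace of `[0, t]` the operator `S` is invertible: there the resolvent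
`G = (1 + S)⁻¹` has norm at most `(1 + t)⁻¹ < 1`, and `S⁻¹ = G (1 - G)⁻¹`. -/
theorem exists_apply_eq (hE : E.IsResolutionOf S) (hS : IsPositiveSelfAdjoint S) {t : ℝ}
    (ht : 0 < t) {z : H} (hz : E.proj t z = 0) : ∃ x : S.domain, S x = z := by
  obtain ⟨G, -, -, hleft, hright⟩ := hS.exists_resolvent
  have hcomm : ∀ y, E.proj t (G y) = G (E.proj t y) := by
    intro y
    obtain ⟨h, hy⟩ := hright y
    have h1 := hleft ⟨_, hE.proj_mem_domain t h⟩
    rw [hE.apply_proj hS t ⟨G y, h⟩, ← map_add, hy] at h1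
    exact h1.symm
  set B : H →L[ℂ] H := G ∘L (1 - E.proj t) with hB
  have hBx : ∀ x, B x = G (x - E.proj t x) := fun x => rfl
  have hnorm : ‖B‖ ≤ (1 + t)⁻¹ := by
    refine ContinuousLinearMap.opNorm_le_bound _ (by positivity) fun x => ?_
    set v := x - E.proj t x with hv
    have hvE : E.proj t v = 0 := sub_proj t x
    obtain ⟨h, hy⟩ := hright v
    have h1 : E.proj t (G v) = 0 := by rw [hcomm, hvE, map_zero]
    have h2 := hE.le_inner_re ⟨G v, h⟩ h1
    have h3 : (⟪G v, v⟫_ℂ).re = ‖G v‖ ^ 2 + (⟪G v, S ⟨G v, h⟩⟫_ℂ).re := by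
      have h4 := congrArg (fun w => (⟪G v, w⟫_ℂ).re) hy.symm
      rwa [inner_add_right, Complex.add_re, re_inner_self] at h4
    have h4 : (⟪G v, v⟫_ℂ).re ≤ ‖G v‖ * ‖v‖ := re_inner_le_norm (𝕜 := ℂ) _ _
    have h5 : ‖v‖ ≤ ‖x‖ := by
      have := (E.isStarProjection t).norm_sq_add x
      rw [← sq_le_sq₀ (norm_nonneg _) (norm_nonneg _)]
      nlinarith [sq_nonneg ‖E.proj t x‖]
    rw [hBx, inv_mul_eq_div, le_div_iff₀ (by positivity)]
    rcases (norm_nonneg (G v)).eq_or_lt with h0 | h0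
    · rw [← h0, zero_mul]; positivity
    · refine le_trans (le_of_mul_le_mul_left ?_ h0) h5
      have h2' : t * ‖G v‖ ^ 2 ≤ (⟪G v, S ⟨G v, h⟩⟫_ℂ).re := h2
      nlinarith
  have hlt : ‖B‖ < 1 := hnorm.trans_lt (inv_lt_one_of_one_lt₀ (by linarith))
  set w := (↑(Units.oneSub B hlt)⁻¹ : H →L[ℂ] H) z with hw
  have hwz : w - B w = z :=
    congrArg (fun C : H →L[ℂ] H => C z) (Units.oneSub B hlt).mul_inv
  have hwE : E.proj t w = 0 := by
    have h1 := congrArg (E.proj t) hwz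
    rw [map_sub, hBx, hcomm, sub_proj, map_zero, sub_zero, hz] at h1
    exact h1
  rw [hBx, hwE, sub_zero] at hwz
  obtain ⟨h, hy⟩ := hright w
  exact ⟨⟨G w, h⟩, by rw [← hwz]; exact eq_sub_of_add_eq' hy⟩

/-- Spectral subspaces are invariant under operators commuting with `S`. For `y` in the range of
`E t` and `s > t`, the vectors `X (S ^ n y)` with `X = (1 - E s) U` have norm at least
`s ^ n ‖X y‖`, but `‖S ^ n y‖ ≤ t ^ n ‖y‖`; so `X y = 0`. -/
theorem proj_apply_of_commute (hE : E.IsResolutionOf S) (hS : IsPositiveSelfAdjoint S)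
    {U : H →L[ℂ] H} (hU : ∀ x : S.domain, ∃ h : U x ∈ S.domain, S ⟨U x, h⟩ = U (S x))
    {t : ℝ} (ht : 0 < t) {y : H} (hy : E.proj t y = y) : E.proj t (U y) = U y := by
  have key : ∀ s, t < s → ∀ (n : ℕ) (y : H), E.proj t y = y →
      s ^ n * ‖U y - E.proj s (U y)‖ ≤ t ^ n * (‖U‖ * ‖y‖) := by
    intro s hs n
    induction n with
    | zero =>
      intro y _
      rw [pow_zero, pow_zero, one_mul, one_mul]
      have h := (E.isStarProjection s).norm_sq_add (U y)
      refine le_trans ?_ (U.le_opNorm y)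
      rw [← sq_le_sq₀ (norm_nonneg _) (norm_nonneg _)]
      nlinarith [sq_nonneg ‖E.proj s (U y)‖]
    | succ n ih =>
      intro y hy
      set y' : S.domain := ⟨y, hE.mem_domain_of_proj_eq hS hy⟩ with hy'
      have h1 := ih (S y') (hE.proj_apply_of_proj_eq hS y' hy)
      have h2 := hE.norm_apply_le hS ht y' hy
      obtain ⟨h, hUy⟩ := hU y'
      have h3 := hE.le_norm_apply ((⟨U y', h⟩ : S.domain) - ⟨_, hE.proj_mem_domain s h⟩)
        (sub_proj s (U y))
      rw [S.map_sub, hE.apply_proj hS s ⟨U y', h⟩, hUy] at h3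
      have h3' : s * ‖U y - E.proj s (U y)‖ ≤ ‖U (S y') - E.proj s (U (S y'))‖ := h3
      have hs0 : 0 < s := ht.trans hs
      calc s ^ (n + 1) * ‖U y - E.proj s (U y)‖ = s ^ n * (s * ‖U y - E.proj s (U y)‖) := by ring
        _ ≤ s ^ n * ‖U (S y') - E.proj s (U (S y'))‖ := by gcongr
        _ ≤ t ^ n * (‖U‖ * ‖S y'‖) := h1
        _ ≤ t ^ n * (‖U‖ * (t * ‖y‖)) := by gcongr
        _ = t ^ (n + 1) * (‖U‖ * ‖y‖) := by ring
  have hgt : ∀ s, t < s → E.proj s (U y) = U y := by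
    intro s hs
    have hs0 : 0 < s := ht.trans hs
    have h1 : ∀ n : ℕ, ‖U y - E.proj s (U y)‖ ≤ (t / s) ^ n * (‖U‖ * ‖y‖) := fun n => by
      have := key s hs n y hy
      rw [div_pow, div_mul_eq_mul_div, le_div_iff₀ (by positivity)]
      linarith
    have h2 : Tendsto (fun n : ℕ => (t / s) ^ n * (‖U‖ * ‖y‖)) atTop (𝓝 0) := by
      simpa using (tendsto_pow_atTop_nhds_zero_of_lt_one (by positivity)
        ((div_lt_one hs0).2 hs)).mul_const (‖U‖ * ‖y‖)
    have h3 := ge_of_tendsto' h2 h1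
    exact (sub_eq_zero.1 (norm_le_zero_iff.1 h3)).symm
  refine tendsto_nhds_unique (E.right_continuous (U y) t) (tendsto_const_nhds.congr' ?_)
  filter_upwards [self_mem_nhdsWithin] with s hs using (hgt s hs).symm

end SpectralFamily.IsResolutionOf

end Resolution

/-! ### Invariant projections and the off-diagonal operator -/

section Invariance

theorem orthogonal_smul_mem {A : Type*} [CStarAlgebra A] [PartialOrder A] [StarOrderedRing A]
    (τ : FiniteTrace A) {H : Type*} [NormedAddCommGroup H] [InnerProductSpace ℂ H]
    [Module Aᵐᵒᵖ H] [h : AHilbertSpace τ H] {U : Submodule ℂ H}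
    (hU : ∀ (a : A), ∀ x ∈ U, MulOpposite.op a • x ∈ U) :
    ∀ (a : A), ∀ x ∈ Uᗮ, MulOpposite.op a • x ∈ Uᗮ := fun a x hx y hy => by
  rw [← h.compatible]
  exact hx _ (hU _ y hy)

variable {A : Type*} [CStarAlgebra A] [PartialOrder A] [StarOrderedRing A] (τ : FiniteTrace A)
  {H : Type*} [NormedAddCommGroup H] [InnerProductSpace ℂ H] [CompleteSpace H] [Module Aᵐᵒᵖ H]
  {H' : Type*} [NormedAddCommGroup H'] [InnerProductSpace ℂ H'] [CompleteSpace H']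
  [Module Aᵐᵒᵖ H']

/-- A projection whose range is `A`-invariant is `A`-linear: the orthogonal complement of the
range is `A`-invariant as well, because `A` is closed under `*`. -/
theorem _root_.IsStarProjection.isALinear [h : AHilbertSpace τ H] {p : H →L[ℂ] H}
    (hp : IsStarProjection p)
    (hinv : ∀ (a : A) x, p x = x → p (MulOpposite.op a • x) = MulOpposite.op a • x) :
    IsALinear A p := fun a x => by
  have hsymm : ∀ u v, ⟪u, p v⟫_ℂ = ⟪p u, v⟫_ℂ := fun u v => by
    rw [← ContinuousLinearMap.adjoint_inner_left, hp.isSelfAdjoint.adjoint_eq]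
  have hid : ∀ u, p (p u) = p u := fun u =>
    congrArg (fun B : H →L[ℂ] H => B u) hp.isIdempotentElem.eq
  refine ext_inner_left ℂ fun w => ?_
  rw [hsymm, ← h.compatible, ← hinv _ _ (hid w), ← hsymm, h.compatible, ← hsymm, hinv _ _ (hid x)]

theorem isALinear_starProjection [h : AHilbertSpace τ H] {U : Submodule ℂ H}
    (hU : ∀ (a : A), ∀ x ∈ U, MulOpposite.op a • x ∈ U) :
    IsALinear A U.topologicalClosure.starProjection := by
  refine isStarProjection_starProjection.isALinear τ fun a x hx => ?_
  rw [Submodule.starProjection_eq_self_iff] at hx ⊢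
  obtain ⟨R, hR⟩ := exists_continuousLinearMap_smul τ H a
  rw [← hR]
  refine closure_minimal (t := R ⁻¹' (U.topologicalClosure : Set H)) (fun y hy => ?_)
    (U.isClosed_topologicalClosure.preimage R.continuous) hx
  rw [Set.mem_preimage, hR]
  exact U.le_topologicalClosure (hU a y hy)

open ContinuousLinearMap in
theorem adjoint_comp_self_linearIsometry (ι : H →ₗᵢ[ℂ] H') (x : H) :
    adjoint ι.toContinuousLinearMap (ι x) = x := by
  refine ext_inner_left ℂ fun y => ?_
  rw [adjoint_inner_right]
  exact ι.inner_map_map y x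

open ContinuousLinearMap in
theorem _root_.IsStarProjection.conj_linearIsometry {p : H →L[ℂ] H} (hp : IsStarProjection p)
    (ι : H →ₗᵢ[ℂ] H') :
    IsStarProjection (ι.toContinuousLinearMap ∘L p ∘L adjoint ι.toContinuousLinearMap) := by
  refine ⟨?_, ?_⟩
  · ext x
    simp only [mul_apply_eq_comp, comp_apply, LinearIsometry.coe_toContinuousLinearMap,
      adjoint_comp_self_linearIsometry]
    rw [← mul_apply_eq_comp p p, hp.isIdempotentElem.eq]
  · rw [isSelfAdjoint_iff']
    rw [adjoint_comp, adjoint_comp, adjoint_adjoint, hp.isSelfAdjoint.adjoint_eq, comp_assoc]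

open ContinuousLinearMap in
theorem vnTrace_conj_linearIsometry [AHilbertSpace τ H] [AHilbertSpace τ H'] {p : H →L[ℂ] H}
    (hp : IsStarProjection p) (hpA : IsALinear A p) (ι : H →ₗᵢ[ℂ] H')
    (hι : IsALinear A ι.toContinuousLinearMap) :
    vnTrace τ (ι.toContinuousLinearMap ∘L p ∘L adjoint ι.toContinuousLinearMap) =
      vnTrace τ p := by
  have h := vnTrace_adjoint_comp_self τ (hι.comp hpA)
  have h1 : adjoint (ι.toContinuousLinearMap ∘L p) ∘L (ι.toContinuousLinearMap ∘L p) = p := by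
    ext x
    rw [adjoint_comp, hp.isSelfAdjoint.adjoint_eq]
    simp only [comp_apply, LinearIsometry.coe_toContinuousLinearMap,
      adjoint_comp_self_linearIsometry]
    rw [← mul_apply_eq_comp p p, hp.isIdempotentElem.eq]
  have h2 : (ι.toContinuousLinearMap ∘L p) ∘L adjoint (ι.toContinuousLinearMap ∘L p) =
      ι.toContinuousLinearMap ∘L p ∘L adjoint ι.toContinuousLinearMap := by
    ext x
    rw [adjoint_comp, hp.isSelfAdjoint.adjoint_eq]
    simp only [comp_apply]
    rw [← mul_apply_eq_comp p p, hp.isIdempotentElem.eq]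
  rw [h1, h2] at h
  exact h.symm

theorem SpectralFamily.IsResolutionOf.isALinear_proj [AHilbertSpace τ H] {E : SpectralFamily H}
    {S : H →ₗ.[ℂ] H} (hE : E.IsResolutionOf S) (hS : IsPositiveSelfAdjoint S)
    (hSA : ∀ (a : A) (x : S.domain), ∃ h : MulOpposite.op a • (x : H) ∈ S.domain,
      S ⟨MulOpposite.op a • (x : H), h⟩ = MulOpposite.op a • S x) {t : ℝ} (ht : 0 < t) :
    IsALinear A (E.proj t) :=
  (E.isStarProjection t).isALinear τ fun a x hx => by
    obtain ⟨R, hR⟩ := exists_continuousLinearMap_smul τ H a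
    rw [← hR]
    refine hE.proj_apply_of_commute hS (fun y => ?_) ht hx
    simp only [hR]
    exact hSA a y

end Invariance

section Summands

variable {H₁ H₂ : Type*} [NormedAddCommGroup H₁] [InnerProductSpace ℂ H₁]
  [NormedAddCommGroup H₂] [InnerProductSpace ℂ H₂]

theorem inlIso_apply (x : H₁) : inlIso H₁ H₂ x = WithLp.toLp 2 (x, 0) := rfl

theorem inrIso_apply (y : H₂) : inrIso H₁ H₂ y = WithLp.toLp 2 (0, y) := rfl

theorem isALinear_inlIso (A : Type*) [CStarAlgebra A] [Module Aᵐᵒᵖ H₁] [Module Aᵐᵒᵖ H₂] :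
    IsALinear A (inlIso H₁ H₂).toContinuousLinearMap := fun a x => by
  change WithLp.toLp 2 (MulOpposite.op a • x, (0 : H₂)) = MulOpposite.op a • WithLp.toLp 2 (x, 0)
  rw [← WithLp.toLp_smul, Prod.smul_mk, smul_zero]

theorem isALinear_inrIso (A : Type*) [CStarAlgebra A] [Module Aᵐᵒᵖ H₁] [Module Aᵐᵒᵖ H₂] :
    IsALinear A (inrIso H₁ H₂).toContinuousLinearMap := fun a y => by
  change WithLp.toLp 2 ((0 : H₁), MulOpposite.op a • y) = MulOpposite.op a • WithLp.toLp 2 (0, y)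
  rw [← WithLp.toLp_smul, Prod.smul_mk, smul_zero]

variable [CompleteSpace H₁] [CompleteSpace H₂]

theorem adjoint_inlIso_apply (z : WithLp 2 (H₁ × H₂)) :
    ContinuousLinearMap.adjoint (inlIso H₁ H₂).toContinuousLinearMap z = z.fst := by
  refine ext_inner_left ℂ fun x => ?_
  rw [ContinuousLinearMap.adjoint_inner_right, LinearIsometry.coe_toContinuousLinearMap,
    inlIso_apply, WithLp.prod_inner_apply]
  simp

theorem adjoint_inrIso_apply (z : WithLp 2 (H₁ × H₂)) :
    ContinuousLinearMap.adjoint (inrIso H₁ H₂).toContinuousLinearMap z = z.snd := by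
  refine ext_inner_left ℂ fun x => ?_
  rw [ContinuousLinearMap.adjoint_inner_right, LinearIsometry.coe_toContinuousLinearMap,
    inrIso_apply, WithLp.prod_inner_apply]
  simp

end Summands

section OffDiag

variable {H₁ H₂ : Type*} [NormedAddCommGroup H₁] [InnerProductSpace ℂ H₁] [CompleteSpace H₁]
  [NormedAddCommGroup H₂] [InnerProductSpace ℂ H₂] {T : H₁ →ₗ.[ℂ] H₂}

theorem inner_adjoint_apply (hd : Dense (T.domain : Set H₁)) (y : T.adjoint.domain)
    (x : T.domain) : ⟪T.adjoint y, (x : H₁)⟫_ℂ = ⟪(y : H₂), T x⟫_ℂ :=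
  T.adjoint_isFormalAdjoint hd y x

theorem offDiag_apply (z : (offDiag T).domain) : offDiag T z = WithLp.toLp 2
    (T.adjoint ⟨(z : WithLp 2 (H₁ × H₂)).snd, z.2.2⟩, T ⟨(z : WithLp 2 (H₁ × H₂)).fst, z.2.1⟩) :=
  rfl

theorem offDiag_symm (hd : Dense (T.domain : Set H₁)) (z w : (offDiag T).domain) :
    ⟪offDiag T z, (w : WithLp 2 (H₁ × H₂))⟫_ℂ = ⟪(z : WithLp 2 (H₁ × H₂)), offDiag T w⟫_ℂ := by
  rw [offDiag_apply, offDiag_apply, WithLp.prod_inner_apply, WithLp.prod_inner_apply]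
  have h1 := inner_adjoint_apply hd ⟨_, z.2.2⟩ ⟨_, w.2.1⟩
  have h2 := congrArg (starRingEnd ℂ) (inner_adjoint_apply hd ⟨_, w.2.2⟩ ⟨_, z.2.1⟩)
  rw [inner_conj_symm, inner_conj_symm] at h2
  change ⟪T.adjoint _, _⟫_ℂ + ⟪T _, _⟫_ℂ = ⟪_, T.adjoint _⟫_ℂ + ⟪_, T _⟫_ℂ
  rw [add_comm]
  exact congrArg₂ (· + ·) h2.symm h1

theorem square_apply {H : Type*} [NormedAddCommGroup H] [InnerProductSpace ℂ H]
    (S : H →ₗ.[ℂ] H) {x : H} (h : x ∈ S.domain) (h' : S ⟨x, h⟩ ∈ S.domain) :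
    square S ⟨x, (mem_squareDomain S x).2 ⟨h, h'⟩⟩ = S ⟨S ⟨x, h⟩, h'⟩ := rfl

theorem inner_square_offDiag (hd : Dense (T.domain : Set H₁))
    (z : (square (offDiag T)).domain) (w : (offDiag T).domain) :
    ⟪square (offDiag T) z, (w : WithLp 2 (H₁ × H₂))⟫_ℂ =
      ⟪offDiag T ⟨z, ((mem_squareDomain _ _).1 z.2).1⟩, offDiag T w⟫_ℂ :=
  offDiag_symm hd ⟨_, ((mem_squareDomain _ _).1 z.2).2⟩ w

theorem inner_self_square_offDiag (hd : Dense (T.domain : Set H₁))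
    (z : (square (offDiag T)).domain) :
    (⟪(z : WithLp 2 (H₁ × H₂)), square (offDiag T) z⟫_ℂ).re =
      ‖offDiag T ⟨z, ((mem_squareDomain _ _).1 z.2).1⟩‖ ^ 2 := by
  have h := inner_square_offDiag hd z ⟨z, ((mem_squareDomain _ _).1 z.2).1⟩
  rw [← re_inner_self, ← h, ← inner_conj_symm, Complex.conj_re]

variable [CompleteSpace H₂]

/-- The orthogonal complement of the graph of `T` is `{(-T* y, y)}`. -/
theorem exists_graph_decomposition (hd : Dense (T.domain : Set H₁)) (hc : T.IsClosed)
    (a : H₁) (b : H₂) : ∃ (x : T.domain) (y : T.adjoint.domain),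
      (x : H₁) - T.adjoint y = a ∧ T x + y = b := by
  set e := WithLp.prodContinuousLinearEquiv 2 ℂ H₁ H₂ with he
  set Γ : Submodule ℂ (WithLp 2 (H₁ × H₂)) :=
    T.graph.comap e.toLinearEquiv.toLinearMap with hΓ
  have hΓc : IsClosed (Γ : Set (WithLp 2 (H₁ × H₂))) := hc.preimage e.continuous
  have hcomplete : CompleteSpace Γ := hΓc.completeSpace_coe
  set z : WithLp 2 (H₁ × H₂) := WithLp.toLp 2 (a, b) with hz
  have hmem : Γ.starProjection z ∈ Γ := Γ.starProjection_apply_mem z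
  have hort := Γ.sub_starProjection_mem_orthogonal z
  set g := Γ.starProjection z with hg
  obtain ⟨x, hx1, hx2⟩ := (LinearPMap.mem_graph_iff T).1 hmem
  set w := z - g with hw
  have hwx : ∀ u : T.domain, ⟪(u : H₁), w.fst⟫_ℂ + ⟪T u, w.snd⟫_ℂ = 0 := by
    intro u
    have hu : WithLp.toLp 2 ((u : H₁), T u) ∈ Γ := T.mem_graph u
    have := hort _ hu
    rw [WithLp.prod_inner_apply] at this
    exact this
  have hwy : ∀ u : T.domain, ⟪-w.fst, (u : H₁)⟫_ℂ = ⟪w.snd, T u⟫_ℂ := by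
    intro u
    have h := congrArg (starRingEnd ℂ) (hwx u)
    rw [map_add, inner_conj_symm, inner_conj_symm, map_zero] at h
    rw [inner_neg_left]
    exact neg_eq_of_add_eq_zero_right h
  have hdom : w.snd ∈ T.adjoint.domain := T.mem_adjoint_domain_of_exists _ ⟨_, hwy⟩
  have hadj : T.adjoint ⟨w.snd, hdom⟩ = -w.fst := T.adjoint_apply_eq hd _ hwy
  refine ⟨x, ⟨w.snd, hdom⟩, ?_, ?_⟩
  · rw [hadj, hx1]
    change g.fst - -(a - g.fst) = a
    abel
  · rw [hx2]
    change g.snd + (b - g.snd) = b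
    abel

theorem isPositiveSelfAdjoint_square_offDiag (hd : Dense (T.domain : Set H₁)) (hc : T.IsClosed) :
    IsPositiveSelfAdjoint (square (offDiag T)) where
  symm z w := by
    rw [inner_square_offDiag hd z ⟨w, ((mem_squareDomain _ _).1 w.2).1⟩,
      ← inner_conj_symm (z : WithLp 2 (H₁ × H₂)),
      inner_square_offDiag hd w ⟨z, ((mem_squareDomain _ _).1 z.2).1⟩, inner_conj_symm]
  nonneg z := by
    rw [inner_self_square_offDiag hd]; positivity
  surj z := by
    -- Decompose `(a, 0)` and `(0, b)`; the components `x` and `y'` solve the two equations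
    -- `x + T* T x = a` and `y' + T T* y' = b`.
    obtain ⟨x, y, h1, h2⟩ := exists_graph_decomposition hd hc z.fst 0
    obtain ⟨x', y', h3, h4⟩ := exists_graph_decomposition hd hc 0 z.snd
    have hy : T x = -(y : H₂) := eq_neg_of_add_eq_zero_left h2
    have hx' : T.adjoint y' = x' := (sub_eq_zero.1 h3).symm
    have hTx : T x ∈ T.adjoint.domain := by rw [hy]; exact neg_mem y.2
    have hTy : T.adjoint y' ∈ T.domain := by rw [hx']; exact x'.2
    have hmem : WithLp.toLp 2 ((x : H₁), (y' : H₂)) ∈ (offDiag T).domain := ⟨x.2, y'.2⟩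
    have hmem' : offDiag T ⟨_, hmem⟩ ∈ (offDiag T).domain := ⟨hTy, hTx⟩
    refine ⟨⟨_, (mem_squareDomain _ _).2 ⟨hmem, hmem'⟩⟩, ?_⟩
    rw [square_apply _ hmem hmem']
    have e1 : T.adjoint ⟨T x, hTx⟩ = -T.adjoint y := by
      rw [← LinearPMap.map_neg]
      congr 1
      exact Subtype.ext hy
    have e2 : T ⟨T.adjoint y', hTy⟩ = T x' := by
      congr 1
      exact Subtype.ext hx'
    refine (WithLp.equiv 2 (H₁ × H₂)).injective (Prod.ext ?_ ?_)
    · change (x : H₁) + T.adjoint ⟨T x, hTx⟩ = z.fst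
      rw [e1, ← sub_eq_add_neg, h1]
    · change (y' : H₂) + T ⟨T.adjoint y', hTy⟩ = z.snd
      rw [e2, add_comm, h4]

end OffDiag

section AOperator

theorem IsClosedAOperator.kernel_smul {A : Type*} [CStarAlgebra A] {H₁ H₂ : Type*}
    [NormedAddCommGroup H₁] [InnerProductSpace ℂ H₁] [Module Aᵐᵒᵖ H₁] [NormedAddCommGroup H₂]
    [InnerProductSpace ℂ H₂] [Module Aᵐᵒᵖ H₂] {T : H₁ →ₗ.[ℂ] H₂} (hT : IsClosedAOperator A T)
    (a : A) (x : H₁) (hx : x ∈ kernel T) : MulOpposite.op a • x ∈ kernel T := by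
  obtain ⟨u, hu, rfl⟩ := hx
  obtain ⟨h, e⟩ := hT.smul a u
  have hu' : T u = 0 := hu
  rw [hu', smul_zero] at e
  exact ⟨⟨_, h⟩, e, rfl⟩

variable {A : Type*} [CStarAlgebra A] [PartialOrder A] [StarOrderedRing A] (τ : FiniteTrace A)
  {H₁ H₂ : Type*} [NormedAddCommGroup H₁] [InnerProductSpace ℂ H₁] [CompleteSpace H₁]
  [Module Aᵐᵒᵖ H₁] [NormedAddCommGroup H₂] [InnerProductSpace ℂ H₂] [Module Aᵐᵒᵖ H₂]
  {T : H₁ →ₗ.[ℂ] H₂}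

theorem IsClosedAOperator.adjoint_smul [h₁ : AHilbertSpace τ H₁] [h₂ : AHilbertSpace τ H₂]
    (hT : IsClosedAOperator A T) (a : A) (y : T.adjoint.domain) :
    ∃ h : MulOpposite.op a • (y : H₂) ∈ T.adjoint.domain,
      T.adjoint ⟨MulOpposite.op a • (y : H₂), h⟩ = MulOpposite.op a • T.adjoint y := by
  have key : ∀ x : T.domain, ⟪MulOpposite.op a • T.adjoint y, (x : H₁)⟫_ℂ =
      ⟪MulOpposite.op a • (y : H₂), T x⟫_ℂ := by
    intro x
    obtain ⟨hx, hTx⟩ := hT.smul (star a) x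
    have h1 := h₁.compatible (star a) (T.adjoint y) x
    have h2 := h₂.compatible (star a) y (T x)
    rw [star_star] at h1 h2
    rw [h1, h2, ← hTx, ← inner_adjoint_apply hT.dense]
  have hdom : MulOpposite.op a • (y : H₂) ∈ T.adjoint.domain :=
    T.mem_adjoint_domain_of_exists _ ⟨_, key⟩
  exact ⟨hdom, T.adjoint_apply_eq hT.dense ⟨_, hdom⟩ key⟩

theorem IsClosedAOperator.offDiag_smul [AHilbertSpace τ H₁] [AHilbertSpace τ H₂]
    (hT : IsClosedAOperator A T) (a : A) (z : (offDiag T).domain) :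
    ∃ h : MulOpposite.op a • (z : WithLp 2 (H₁ × H₂)) ∈ (offDiag T).domain,
      offDiag T ⟨MulOpposite.op a • (z : WithLp 2 (H₁ × H₂)), h⟩ =
        MulOpposite.op a • offDiag T z := by
  obtain ⟨h1, e1⟩ := hT.smul a ⟨_, z.2.1⟩
  obtain ⟨h2, e2⟩ := hT.adjoint_smul τ a ⟨_, z.2.2⟩
  exact ⟨⟨h1, h2⟩, (WithLp.equiv 2 (H₁ × H₂)).injective (Prod.ext e2 e1)⟩

theorem IsClosedAOperator.square_offDiag_smul [AHilbertSpace τ H₁] [AHilbertSpace τ H₂]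
    (hT : IsClosedAOperator A T) (a : A) (z : (square (offDiag T)).domain) :
    ∃ h : MulOpposite.op a • (z : WithLp 2 (H₁ × H₂)) ∈ (square (offDiag T)).domain,
      square (offDiag T) ⟨MulOpposite.op a • (z : WithLp 2 (H₁ × H₂)), h⟩ =
        MulOpposite.op a • square (offDiag T) z := by
  obtain ⟨hz, hz'⟩ := (mem_squareDomain _ _).1 z.2
  obtain ⟨h1, e1⟩ := hT.offDiag_smul τ a ⟨z, hz⟩
  obtain ⟨h2, e2⟩ := hT.offDiag_smul τ a ⟨_, hz'⟩
  have h2' : offDiag T ⟨_, h1⟩ ∈ (offDiag T).domain := by rw [e1]; exact h2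
  refine ⟨(mem_squareDomain _ _).2 ⟨h1, h2'⟩, ?_⟩
  rw [square_apply _ h1 h2']
  have h3 : offDiag T ⟨offDiag T ⟨_, h1⟩, h2'⟩ = offDiag T ⟨_, h2⟩ := by
    congr 1
    exact Subtype.ext e1
  rw [h3, e2]
  rfl

end AOperator

/-! ### Fredholmness and the spectral counting function -/

section Fredholm

/-- If the image of the closed operator `T` contains the closed subspace `L`, then by the open
mapping theorem, applied to the part of the graph of `T` over `L`, the operator `T` is bounded
below on the part of `(ker T)ᗮ` mapped to `L`. -/
theorem exists_norm_le_of_subset_range {H₁ H₂ : Type*} [NormedAddCommGroup H₁]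
    [InnerProductSpace ℂ H₁] [CompleteSpace H₁] [NormedAddCommGroup H₂] [InnerProductSpace ℂ H₂]
    [CompleteSpace H₂] {T : H₁ →ₗ.[ℂ] H₂} (hc : T.IsClosed)
    {L : Submodule ℂ H₂} (hL : IsClosed (L : Set H₂)) (hLT : (L : Set H₂) ⊆ Set.range T) :
    ∃ C : ℝ, 0 < C ∧ (∀ y ∈ L, ∃ x : T.domain, T x = y ∧ ‖(x : H₁)‖ ≤ C * ‖y‖) ∧
      ∀ x : T.domain, (x : H₁) ∈ (kernel T)ᗮ → T x ∈ L → ‖(x : H₁)‖ ≤ C * ‖T x‖ := by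
  set M : Submodule ℂ (H₁ × H₂) :=
    T.graph ⊓ L.comap (ContinuousLinearMap.snd ℂ H₁ H₂).toLinearMap with hM
  have hMc : IsClosed (M : Set (H₁ × H₂)) :=
    IsClosed.inter hc (hL.preimage (ContinuousLinearMap.snd ℂ H₁ H₂).continuous)
  have hM' : CompleteSpace M := hMc.completeSpace_coe
  have hL' : CompleteSpace L := hL.completeSpace_coe
  let f : M →L[ℂ] L :=
    ((ContinuousLinearMap.snd ℂ H₁ H₂).comp M.subtypeL).codRestrict L fun p => p.2.2
  have hf : Function.Surjective f := by
    rintro ⟨y, hy⟩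
    obtain ⟨x, rfl⟩ := hLT hy
    exact ⟨⟨((x : H₁), T x), T.mem_graph x, hy⟩, rfl⟩
  obtain ⟨C, hC, h⟩ := f.exists_preimage_norm_le hf
  have h1 : ∀ y ∈ L, ∃ x : T.domain, T x = y ∧ ‖(x : H₁)‖ ≤ C * ‖y‖ := by
    intro y hy
    obtain ⟨⟨⟨p₁, p₂⟩, hp⟩, hpy, hpn⟩ := h ⟨y, hy⟩
    have e : p₂ = y := congrArg Subtype.val hpy
    obtain ⟨x, hx1, hx2⟩ := (LinearPMap.mem_graph_iff T).1 hp.1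
    refine ⟨x, hx2.trans e, ?_⟩
    have hx1' : (x : H₁) = p₁ := hx1
    rw [hx1']
    exact (norm_fst_le (p₁, p₂)).trans hpn
  refine ⟨C, hC, h1, fun x hx hTx => ?_⟩
  obtain ⟨x', hx', hn⟩ := h1 _ hTx
  refine le_trans ?_ hn
  -- `x` is the component of `x'` orthogonal to the kernel.
  have hk : (x' : H₁) - x ∈ kernel T := ⟨x' - x, by
    change T (x' - x) = 0
    rw [T.map_sub, hx', sub_self], rfl⟩
  have hort : ⟪(x : H₁), (x' : H₁) - x⟫_ℂ = 0 := by
    rw [← inner_conj_symm, hx _ hk, map_zero]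
  have hpy := norm_add_sq_eq_norm_sq_add_norm_sq_of_inner_eq_zero (𝕜 := ℂ) _ _ hort
  rw [add_sub_cancel] at hpy
  nlinarith [norm_nonneg (x : H₁), norm_nonneg (x' : H₁), norm_nonneg ((x' : H₁) - x)]

variable {A : Type*} [CStarAlgebra A] [PartialOrder A] [StarOrderedRing A] (τ : FiniteTrace A)
  {H₁ H₂ : Type*} [NormedAddCommGroup H₁] [InnerProductSpace ℂ H₁] [CompleteSpace H₁]
  [Module Aᵐᵒᵖ H₁] [NormedAddCommGroup H₂] [InnerProductSpace ℂ H₂] [CompleteSpace H₂]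
  [Module Aᵐᵒᵖ H₂] [AHilbertSpace τ H₁] [AHilbertSpace τ H₂] {T : H₁ →ₗ.[ℂ] H₂}
  {E : SpectralFamily (WithLp 2 (H₁ × H₂))}

open ContinuousLinearMap in
/-- On the range of `E t`, with `t` small, `z = (x, y)` is determined by the component of `x` in
the kernel of `T` and by the components of `T x` and `y` orthogonal to `L`. -/
theorem IsTauFredholm.exists_vnTrace_proj_lt (hT : IsClosedAOperator A T)
    (hE : E.IsResolutionOf (square (offDiag T))) (hF : IsTauFredholm τ T) :
    ∃ t : ℝ, 0 < t ∧ vnTrace τ (E.proj t) < ∞ := by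
  obtain ⟨hK, L, ⟨hLc, hLA⟩, hLT, hN⟩ := hF
  have hS := isPositiveSelfAdjoint_square_offDiag hT.dense hT.closed
  obtain ⟨C, hC, hC1, hC2⟩ := exists_norm_le_of_subset_range hT.closed hLc hLT
  set t : ℝ := (2 * C ^ 2)⁻¹ with htdef
  have ht : 0 < t := by positivity
  have htC : C ^ 2 * t = 1 / 2 := by rw [htdef]; field_simp
  refine ⟨t, ht, ?_⟩
  set P := E.proj t with hP
  have hPA : IsALinear A P := hE.isALinear_proj τ hS (hT.square_offDiag_smul τ) ht
  have hPP : ∀ z, P (P z) = P z := E.proj_proj_of_le le_rfl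
  set pK := (kernel T).topologicalClosure.starProjection with hpK
  set pN := Lᗮ.topologicalClosure.starProjection with hpN
  have hpKs : IsStarProjection pK := isStarProjection_starProjection
  have hpNs : IsStarProjection pN := isStarProjection_starProjection
  have hpKA : IsALinear A pK := isALinear_starProjection τ hT.kernel_smul
  have hpNA : IsALinear A pN := isALinear_starProjection τ (orthogonal_smul_mem τ hLA)
  have hpK0 : ∀ x, pK x = 0 → x ∈ (kernel T)ᗮ := fun x hx => by
    rw [← Submodule.orthogonal_closure]
    exact (Submodule.starProjection_apply_eq_zero_iff _).1 hx
  have hpN0 : ∀ y, pN y = 0 → y ∈ L := fun y hy => by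
    have h := (Submodule.starProjection_apply_eq_zero_iff _).1 hy
    rw [Submodule.orthogonal_closure, Submodule.orthogonal_orthogonal_eq_closure,
      hLc.submodule_topologicalClosure_eq] at h
    exact h
  have hdom : ∀ z, P z ∈ (square (offDiag T)).domain := fun z =>
    hE.mem_domain_of_proj_eq hS (hPP z)
  have hdom' : ∀ z, P z ∈ (offDiag T).domain := fun z => ((mem_squareDomain _ _).1 (hdom z)).1
  have hbound : ∀ z, ‖T ⟨(P z).fst, (hdom' z).1⟩‖ ^ 2 +
      ‖T.adjoint ⟨(P z).snd, (hdom' z).2⟩‖ ^ 2 ≤ t * ‖P z‖ ^ 2 := fun z => by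
    have h := hE.inner_re_le ⟨P z, hdom z⟩ (hPP z)
    rw [inner_self_square_offDiag hT.dense, offDiag_apply, WithLp.prod_norm_sq_eq_of_L2] at h
    rw [add_comm]
    exact h
  set ι₁ := (inlIso H₁ H₂).toContinuousLinearMap with hι₁
  set ι₂ := (inrIso H₁ H₂).toContinuousLinearMap with hι₂
  have hι₁A : IsALinear A ι₁ := isALinear_inlIso A
  have hι₂A : IsALinear A ι₂ := isALinear_inrIso A
  -- `W z = T x`, where `x` is the first component of `P z`
  let W₀ : WithLp 2 (H₁ × H₂) →ₗ[ℂ] T.domain :=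
    ((adjoint ι₁ ∘L P).toLinearMap).codRestrict T.domain fun z => by
      change adjoint ι₁ (P z) ∈ T.domain
      rw [hι₁, adjoint_inlIso_apply]
      exact (hdom' z).1
  have hW₀ : ∀ z, W₀ z = ⟨(P z).fst, (hdom' z).1⟩ := fun z =>
    Subtype.ext (adjoint_inlIso_apply (P z))
  let W : WithLp 2 (H₁ × H₂) →L[ℂ] H₂ := (T.toFun ∘ₗ W₀).mkContinuous √t fun z => by
    change ‖T (W₀ z)‖ ≤ √t * ‖z‖
    rw [hW₀]
    refine le_trans (Real.le_sqrt_of_sq_le ?_) (le_of_eq (by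
      rw [Real.sqrt_mul ht.le, Real.sqrt_sq (norm_nonneg z)]))
    have h1 := hbound z
    have h2 : ‖P z‖ ≤ ‖z‖ := by simpa using P.le_of_opNorm_le (E.isStarProjection t).norm_le z
    have h3 : t * ‖P z‖ ^ 2 ≤ t * ‖z‖ ^ 2 := by gcongr
    nlinarith [sq_nonneg ‖T.adjoint ⟨(P z).snd, (hdom' z).2⟩‖]
  have hW : ∀ z, W z = T ⟨(P z).fst, (hdom' z).1⟩ := fun z => congrArg T (hW₀ z)
  have hWA : IsALinear A W := fun a z => by
    obtain ⟨h, e⟩ := hT.smul a ⟨(P z).fst, (hdom' z).1⟩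
    rw [hW, hW, ← e]
    congr 1
    refine Subtype.ext ?_
    change (P (MulOpposite.op a • z)).fst = MulOpposite.op a • (P z).fst
    rw [hPA, WithLp.smul_fst]
  let B : Fin 3 → WithLp 2 (H₁ × H₂) →L[ℂ] WithLp 2 (H₁ × H₂) :=
    ![ι₁ ∘L pK ∘L adjoint ι₁ ∘L P, ι₂ ∘L pN ∘L W, ι₂ ∘L pN ∘L adjoint ι₂ ∘L P]
  let q : Fin 3 → WithLp 2 (H₁ × H₂) →L[ℂ] WithLp 2 (H₁ × H₂) :=
    ![ι₁ ∘L pK ∘L adjoint ι₁, ι₂ ∘L pN ∘L adjoint ι₂, ι₂ ∘L pN ∘L adjoint ι₂]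
  have hKK : ∀ x, pK (pK x) = pK x := fun x =>
    congrArg (fun C : H₁ →L[ℂ] H₁ => C x) hpKs.isIdempotentElem.eq
  have hNN : ∀ x, pN (pN x) = pN x := fun x =>
    congrArg (fun C : H₂ →L[ℂ] H₂ => C x) hpNs.isIdempotentElem.eq
  have hadj₁ : ∀ x, adjoint ι₁ (ι₁ x) = x := adjoint_comp_self_linearIsometry _
  have hadj₂ : ∀ y, adjoint ι₂ (ι₂ y) = y := adjoint_comp_self_linearIsometry _
  have key := vnTrace_le_sum_of_jointly_injective τ Finset.univ (B := B) (q := q) (p := P) ?_ ?_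
    (E.isStarProjection t) ?_ ?_
  · refine key.trans_lt ?_
    rw [Fin.sum_univ_three]
    have e1 : vnTrace τ (q 0) = vnDim τ (kernel T) :=
      vnTrace_conj_linearIsometry τ hpKs hpKA _ hι₁A
    have e2 : vnTrace τ (q 1) = vnDim τ Lᗮ := vnTrace_conj_linearIsometry τ hpNs hpNA _ hι₂A
    have e3 : vnTrace τ (q 2) = vnDim τ Lᗮ := e2
    rw [e1, e2, e3]
    exact ENNReal.add_lt_top.2 ⟨ENNReal.add_lt_top.2 ⟨hK, hN⟩, hN⟩
  · refine Fin.forall_fin_succ.2 ⟨?_, Fin.forall_fin_succ.2 ⟨?_, Fin.forall_fin_one.2 ?_⟩⟩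
    · exact hι₁A.comp (hpKA.comp ((hι₁A.adjoint τ).comp hPA))
    · exact hι₂A.comp (hpNA.comp hWA)
    · exact hι₂A.comp (hpNA.comp ((hι₂A.adjoint τ).comp hPA))
  · refine Fin.forall_fin_succ.2 ⟨?_, Fin.forall_fin_succ.2 ⟨?_, Fin.forall_fin_one.2 ?_⟩⟩
    · exact hpKs.conj_linearIsometry _
    · exact hpNs.conj_linearIsometry _
    · exact hpNs.conj_linearIsometry _
  · refine Fin.forall_fin_succ.2 ⟨fun z => ?_, Fin.forall_fin_succ.2 ⟨fun z => ?_,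
      Fin.forall_fin_one.2 fun z => ?_⟩⟩
    · change ι₁ (pK (adjoint ι₁ (ι₁ (pK _)))) = ι₁ (pK _)
      rw [hadj₁, hKK]
    · change ι₂ (pN (adjoint ι₂ (ι₂ (pN _)))) = ι₂ (pN _)
      rw [hadj₂, hNN]
    · change ι₂ (pN (adjoint ι₂ (ι₂ (pN _)))) = ι₂ (pN _)
      rw [hadj₂, hNN]
  · intro z hz
    have h0 : ι₁ (pK (adjoint ι₁ (P z))) = 0 := hz 0 (Finset.mem_univ _)
    have h1 : ι₂ (pN (W z)) = 0 := hz 1 (Finset.mem_univ _)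
    have h2 : ι₂ (pN (adjoint ι₂ (P z))) = 0 := hz 2 (Finset.mem_univ _)
    have h0' := congrArg (adjoint ι₁) h0
    have h1' := congrArg (adjoint ι₂) h1
    have h2' := congrArg (adjoint ι₂) h2
    rw [hadj₁, map_zero, hι₁, adjoint_inlIso_apply] at h0'
    rw [hadj₂, map_zero, hW] at h1'
    rw [hadj₂, map_zero, hι₂, adjoint_inrIso_apply] at h2'
    have hx := hC2 ⟨(P z).fst, (hdom' z).1⟩ (hpK0 _ h0') (hpN0 _ h1')
    have hy : ‖(P z).snd‖ ≤ C * ‖T.adjoint ⟨(P z).snd, (hdom' z).2⟩‖ := by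
      obtain ⟨x, hxy, hxn⟩ := hC1 _ (hpN0 _ h2')
      have h3 := inner_adjoint_apply hT.dense ⟨(P z).snd, (hdom' z).2⟩ x
      have h4 : ‖(P z).snd‖ ^ 2 = (⟪T.adjoint ⟨(P z).snd, (hdom' z).2⟩, (x : H₁)⟫_ℂ).re := by
        rw [h3, hxy, re_inner_self]
      have h5 : (⟪T.adjoint ⟨(P z).snd, (hdom' z).2⟩, (x : H₁)⟫_ℂ).re ≤
        ‖T.adjoint ⟨(P z).snd, (hdom' z).2⟩‖ * ‖(x : H₁)‖ := re_inner_le_norm (𝕜 := ℂ) _ _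
      have h6 : ‖T.adjoint ⟨(P z).snd, (hdom' z).2⟩‖ * ‖(x : H₁)‖ ≤
        ‖T.adjoint ⟨(P z).snd, (hdom' z).2⟩‖ * (C * ‖(P z).snd‖) := by gcongr
      rcases (norm_nonneg (P z).snd).eq_or_lt with h7 | h7
      · rw [← h7]; positivity
      · exact le_of_mul_le_mul_right (by nlinarith) h7
    have hnorm : ‖P z‖ ^ 2 = ‖(P z).fst‖ ^ 2 + ‖(P z).snd‖ ^ 2 := WithLp.prod_norm_sq_eq_of_L2 _
    have hx2 := pow_le_pow_left₀ (norm_nonneg _) hx 2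
    have hy2 := pow_le_pow_left₀ (norm_nonneg _) hy 2
    have hx2' : ‖(P z).fst‖ ^ 2 ≤ C ^ 2 * ‖T ⟨(P z).fst, (hdom' z).1⟩‖ ^ 2 := by
      rw [← mul_pow]; exact hx2
    rw [mul_pow] at hy2
    have h8 : C ^ 2 * (‖T ⟨(P z).fst, (hdom' z).1⟩‖ ^ 2 +
      ‖T.adjoint ⟨(P z).snd, (hdom' z).2⟩‖ ^ 2) ≤ C ^ 2 * (t * ‖P z‖ ^ 2) := by
      have := hbound z
      gcongr
    rw [← mul_assoc, htC] at h8
    have h9 : ‖P z‖ ^ 2 = 0 := le_antisymm (by linarith) (by positivity)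
    exact norm_eq_zero.1 ((pow_eq_zero_iff two_ne_zero).1 h9)

open ContinuousLinearMap in
/-- If `Tr (E t) < ∞`, then `L = {y | E t (0, y) = 0}` is contained in the image of `T`, its
orthogonal complement is mapped injectively into the range of `E t`, and so is the kernel
of `T`. -/
theorem isTauFredholm_of_vnTrace_proj_lt (hT : IsClosedAOperator A T)
    (hE : E.IsResolutionOf (square (offDiag T))) {t : ℝ} (ht : 0 < t)
    (hfin : vnTrace τ (E.proj t) < ∞) : IsTauFredholm τ T := by
  have hS := isPositiveSelfAdjoint_square_offDiag hT.dense hT.closed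
  set P := E.proj t with hP
  have hPA : IsALinear A P := hE.isALinear_proj τ hS (hT.square_offDiag_smul τ) ht
  have hPP : ∀ z, P (P z) = P z := E.proj_proj_of_le le_rfl
  set ι₁ := (inlIso H₁ H₂).toContinuousLinearMap with hι₁
  set ι₂ := (inrIso H₁ H₂).toContinuousLinearMap with hι₂
  have hι₁A : IsALinear A ι₁ := isALinear_inlIso A
  have hι₂A : IsALinear A ι₂ := isALinear_inrIso A
  constructor
  · set pK := (kernel T).topologicalClosure.starProjection with hpK
    have hpKA : IsALinear A pK := isALinear_starProjection τ hT.kernel_smul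
    have hker : ∀ x ∈ kernel T, P (ι₁ x) = ι₁ x := by
      rintro _ ⟨x, hx, rfl⟩
      have hx' : T x = 0 := hx
      have hmem : ι₁ (x : H₁) ∈ (offDiag T).domain := ⟨x.2, zero_mem _⟩
      have hz : offDiag T ⟨ι₁ (x : H₁), hmem⟩ = 0 := by
        refine (WithLp.equiv 2 (H₁ × H₂)).injective (Prod.ext ?_ ?_)
        · exact T.adjoint.map_zero
        · exact hx'
      have hmem' : offDiag T ⟨ι₁ (x : H₁), hmem⟩ ∈ (offDiag T).domain := by
        rw [hz]; exact zero_mem _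
      refine hE.proj_eq_of_apply_eq_zero hS ht
        ⟨_, (mem_squareDomain _ _).2 ⟨hmem, hmem'⟩⟩ ?_
      rw [square_apply _ hmem hmem', ← (offDiag T).map_zero]
      congr 1
      exact Subtype.ext hz
    have hker' : ∀ x, P (ι₁ (pK x)) = ι₁ (pK x) := fun x =>
      closure_minimal (t := {x | P (ι₁ x) = ι₁ x}) hker
        (isClosed_eq (by fun_prop) (by fun_prop))
        ((kernel T).topologicalClosure.starProjection_apply_mem x)
    have key := vnTrace_le_sum_of_jointly_injective τ (Finset.univ : Finset Unit)
      (B := fun _ => ι₁ ∘L pK) (q := fun _ => P) (p := pK) (fun _ => hι₁A.comp hpKA)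
      (fun _ => E.isStarProjection t) isStarProjection_starProjection (fun _ => hker')
      fun x hx => (inlIso H₁ H₂).injective ((hx () (Finset.mem_univ _)).trans (map_zero _).symm)
    rw [Finset.univ_unique, Finset.sum_singleton] at key
    exact key.trans_lt hfin
  · refine ⟨(P ∘L ι₂).ker, ⟨(P ∘L ι₂).isClosed_ker, fun a y hy => ?_⟩, fun y hy => ?_, ?_⟩
    · have hy' : (P ∘L ι₂) y = 0 := hy
      change (P ∘L ι₂) (MulOpposite.op a • y) = 0
      rw [hPA.comp hι₂A, hy', smul_zero]
    · obtain ⟨w, hw⟩ := hE.exists_apply_eq hS ht (z := ι₂ y) hy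
      obtain ⟨h, h'⟩ := (mem_squareDomain _ _).1 w.2
      exact ⟨⟨(offDiag T ⟨w, h⟩).fst, h'.1⟩, congrArg WithLp.snd hw⟩
    · have key := vnTrace_le_sum_of_jointly_injective τ (Finset.univ : Finset Unit)
        (B := fun _ => P ∘L ι₂) (q := fun _ => P)
        (p := ((P ∘L ι₂).kerᗮ).topologicalClosure.starProjection) (fun _ => hPA.comp hι₂A)
        (fun _ => E.isStarProjection t) isStarProjection_starProjection (fun _ y => hPP _)
        fun y hy => by
          rw [Submodule.starProjection_apply_eq_zero_iff, Submodule.orthogonal_closure]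
          exact Submodule.le_orthogonal_orthogonal _ (hy () (Finset.mem_univ _))
      rw [Finset.univ_unique, Finset.sum_singleton] at key
      exact key.trans_lt hfin

end Fredholm

end VN

end


theorem lemmaL {A : Type*} [CStarAlgebra A] [WStarAlgebra A] [PartialOrder A] [StarOrderedRing A]
    (τ : VN.FiniteTrace A)
    {H₁ : Type*} [NormedAddCommGroup H₁] [InnerProductSpace ℂ H₁] [CompleteSpace H₁]
    [Module Aᵐᵒᵖ H₁] [VN.AHilbertSpace τ H₁]
    {H₂ : Type*} [NormedAddCommGroup H₂] [InnerProductSpace ℂ H₂] [CompleteSpace H₂]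
    [Module Aᵐᵒᵖ H₂] [VN.AHilbertSpace τ H₂]
    (T : H₁ →ₗ.[ℂ] H₂) (hT : VN.IsClosedAOperator A T) :
    VN.IsTauFredholm τ T ↔
      ∃ t : ℝ, 0 < t ∧ VN.spectralCounting τ t (VN.square (VN.offDiag T)) < ∞ := by
  have hex := (VN.isPositiveSelfAdjoint_square_offDiag hT.dense hT.closed).exists_resolution
  have hproj : ∀ t, VN.spectralProjection (VN.square (VN.offDiag T)) t = hex.choose.proj t :=
    fun t => dif_pos hex
  simp only [VN.spectralCounting, hproj]
  exact ⟨fun h => h.exists_vnTrace_proj_lt τ hT hex.choose_spec,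
    fun ⟨_, ht, h⟩ => VN.isTauFredholm_of_vnTrace_proj_lt τ hT hex.choose_spec ht h⟩
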